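/- **Theorem (Gödel's first incompleteness theorem, Rosser form).** Work over the signature $0,S,+,\times,=,\leq$ of first-order arithmetic. Pre-terms are built from variables $v_0,v_1,\dots$; pre-formulas are in negation normal form, i.e. built from literals $s=t$, $\neg s=t$, $s\leq t$, $\neg s\leq t$ by $\land$, $\lor$, $\forall v_{2i}$, $\exists v_{2i}$ (only variables of even index are quantified). Terms and formulas are pre-terms and pre-formulas without free variables of even index; sentences have no free variables; a theory is a set of sentences. Negation $\neg\varphi$ is the operation on pre-formulas given by the De Morgan laws, and $\varphi\to\psi$ is $\neg\varphi\lor\psi$. For a set $\Theta$ of formulas, $\Theta\vdash\varphi$ means that for some finitely many $\theta_1,\dots,\theta_n\in\Theta$ the sequent (finite set of formulas) $\neg\theta_1,\dots,\neg\theta_n,\varphi$ is derivable in the one-sided sequent calculus with the rules: $\vdash\Gamma$ if $\Gamma$ contains a literal and its negation; from $\vdash\Gamma,\varphi$ and $\vdash\Gamma,\psi$ infer $\vdash\Gamma,\varphi\land\psi$; from $\vdash\Gamma,\varphi$ or from $\vdash\Gamma,\psi$ infer $\vdash\Gamma,\varphi\lor\psi$; from $\vdash\Gamma',\varphi[x/y]$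 with $\Gamma'\subseteq\Gamma$ and $y$ a variable of odd index not free in $\Gamma',\forall x\,\varphi$ infer $\vdash\Gamma,\forall x\,\varphi$; from $\vdash\Gamma,\varphi[x/t]$ with $t$ a term infer $\vdash\Gamma,\exists x\,\varphi$; from $\vdash\Gamma,\varphi$ and $\vdash\Gamma,\neg\varphi$ infer $\vdash\Gamma$. The set $\Theta$ is consistent if $\Theta\nvdash\bot$, where $\bot$ is $0=0\land\neg\,0=0$. Robinson arithmetic $\mathsf Q$ consists of the equality axioms (reflexivity, symmetry, transitivity, compatibility of $=$ with all function and relation symbols) and the universal closures of $$Sx=Sy\to x=y,\quad x\neq 0\leftrightarrow\exists y\,x=Sy,\quad x\leq y\leftrightarrow\exists z\,z+x=y,$$ $$x+0=x,\quad x+Sy=S(x+y),\quad x\times 0=0,\quad x\times Sy=(x\times y)+x,$$ with a fixed choice of bound variables. A formula is $\Sigma$ if it is generated from literals by $\land$, $\lor$, bounded quantification $\forall x(x\leq t\to\varphi)$, $\exists x(x\leq t\land\varphi)$ with $x$ not in $t$, and unbounded $\exists x$; it is $\Pi$ if its negation is $\Sigma$. A set $A\subseteq\mathbb N$ is $\Sigma$-definable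 if there is a $\Sigma$-formula $\varphi(x)$ with at most one free variable $x$ such that $a\in A\Leftrightarrow\mathbb N\vDash\varphi(a)$ for all $a\in\mathbb N$. Finite sequences are coded by $\langle\rangle=0$, $\langle a_0,\dots,a_n\rangle=\pi(\langle a_0,\dots,a_{n-1}\rangle,a_n)+1$ with $\pi(m,n)=n+\frac{(m+n)(m+n+1)}2$. Gödel numbers are $\ulcorner v_i\urcorner=\langle0,0,i\rangle$, $\ulcorner0\urcorner=\langle0,1\rangle$, $\ulcorner St\urcorner=\langle0,2,\ulcorner t\urcorner\rangle$, $\ulcorner s+t\urcorner=\langle0,3,\ulcorner s\urcorner,\ulcorner t\urcorner\rangle$, $\ulcorner s\times t\urcorner=\langle0,4,\ulcorner s\urcorner,\ulcorner t\urcorner\rangle$; further, $s=t$, $\neg s=t$, $s\leq t$, $\neg s\leq t$, $\varphi\land\psi$, $\varphi\lor\psi$ have the Gödel number $\langle1,j,a,b\rangle$ with $j=0,\dots,5$ respectively, where $a,b$ are the Gödel numbers of the two components, and $\ulcorner\forall v_{2i}\varphi\urcorner=\langle1,6,2i,\ulcorner\varphi\urcorner\rangle$, $\ulcorner\exists v_{2i}\varphi\urcorner=\langle1,7,2i,\ulcorner\varphi\urcorner\rangle$.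 Let $\mathsf T\supseteq\mathsf Q$ be a theory of first-order arithmetic such that $\{\ulcorner\theta\urcorner\mid\theta\in\mathsf T\}$ is $\Sigma$-definable. If $\mathsf T$ is consistent, then there is a $\Pi$-sentence $\psi$ such that both $\mathsf T\nvdash\psi$ and $\mathsf T\nvdash\neg\psi$. -/

import Mathlib

/-! First-order arithmetic: formulas in negation normal form over the signature `0, S, +, ×, =, ≤`,
a one-sided (Tait style) sequent calculus, Robinson arithmetic, `Σ`- and `Π`-formulas, and Gödel
numbers. Following a common device that makes substitution capture-free, the variables `v₀, v₁, …`
are split: only variables with even index can be quantified, and in proper terms and formulas (as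
opposed to pre-terms and pre-formulas) only variables with odd index occur free. -/

namespace FOArith

/-- Pre-terms. `var i` is the variable `vᵢ`. -/
inductive PreTerm : Type
  | var (i : ℕ)
  | zero
  | succ (t : PreTerm)
  | add (s t : PreTerm)
  | mul (s t : PreTerm)
  deriving DecidableEq

/-- Pre-formulas, in negation normal form: `eq`, `ne`, `le`, `nle` are the literals `s = t`,
`¬ s = t`, `s ≤ t`, `¬ s ≤ t`, while `all i φ` and `ex i φ` are `∀ v₂ᵢ φ` and `∃ v₂ᵢ φ`
(so the bound variable has the *even* index `2 * i`). -/
inductive PreFormula : Type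
  | eq (s t : PreTerm)
  | ne (s t : PreTerm)
  | le (s t : PreTerm)
  | nle (s t : PreTerm)
  | and (φ ψ : PreFormula)
  | or (φ ψ : PreFormula)
  | all (i : ℕ) (φ : PreFormula)
  | ex (i : ℕ) (φ : PreFormula)
  deriving DecidableEq

namespace PreTerm

/-- The set of (indices of) free variables of a pre-term. -/
def FV : PreTerm → Finset ℕ
  | var i => {i}
  | zero => ∅
  | succ t => FV t
  | add s t => FV s ∪ FV t
  | mul s t => FV s ∪ FV t

/-- A term is a pre-term in which no variable with even index occurs. -/
def IsTerm (t : PreTerm) : Prop := ∀ j ∈ FV t, Odd j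

/-- `subst s i t` is the substitution `s[vᵢ/t]`. -/
def subst : PreTerm → ℕ → PreTerm → PreTerm
  | var j, i, t => if i = j then t else var j
  | zero, _, _ => zero
  | succ s, i, t => succ (subst s i t)
  | add r s, i, t => add (subst r i t) (subst s i t)
  | mul r s, i, t => mul (subst r i t) (subst s i t)

/-- The value of a pre-term in the standard model `ℕ` under an assignment `η`. -/
def val (η : ℕ → ℕ) : PreTerm → ℕ
  | var i => η i
  | zero => 0
  | succ t => val η t + 1
  | add s t => val η s + val η t
  | mul s t => val η s * val η t

end PreTerm

namespace PreFormula

/-- The set of (indices of) free variables of a pre-formula. -/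
def FV : PreFormula → Finset ℕ
  | eq s t => s.FV ∪ t.FV
  | ne s t => s.FV ∪ t.FV
  | le s t => s.FV ∪ t.FV
  | nle s t => s.FV ∪ t.FV
  | and φ ψ => FV φ ∪ FV ψ
  | or φ ψ => FV φ ∪ FV ψ
  | all i φ => (FV φ).erase (2 * i)
  | ex i φ => (FV φ).erase (2 * i)

/-- A formula is a pre-formula in which no variable with even index is free. -/
def IsFormula (φ : PreFormula) : Prop := ∀ j ∈ FV φ, Odd j

/-- A sentence is a formula without free variables. -/
def IsSentence (φ : PreFormula) : Prop := FV φ = ∅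

/-- A literal is an atomic formula or a negated atomic formula. -/
def IsLiteral : PreFormula → Prop
  | eq _ _ => True
  | ne _ _ => True
  | le _ _ => True
  | nle _ _ => True
  | _ => False

/-- The negation of a pre-formula, in negation normal form. -/
def neg : PreFormula → PreFormula
  | eq s t => ne s t
  | ne s t => eq s t
  | le s t => nle s t
  | nle s t => le s t
  | and φ ψ => or (neg φ) (neg ψ)
  | or φ ψ => and (neg φ) (neg ψ)
  | all i φ => ex i (neg φ)
  | ex i φ => all i (neg φ)

/-- `φ → ψ` abbreviates `¬ φ ∨ ψ`. -/
def imp (φ ψ : PreFormula) : PreFormula := or (neg φ) ψ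

/-- `φ ↔ ψ` abbreviates `(φ → ψ) ∧ (ψ → φ)`. -/
def iff (φ ψ : PreFormula) : PreFormula := and (imp φ ψ) (imp ψ φ)

/-- Falsity, as the contradiction `0 = 0 ∧ ¬ 0 = 0`. -/
def falsum : PreFormula := and (eq .zero .zero) (ne .zero .zero)

/-- `subst φ i t` is the substitution `φ[vᵢ/t]`. It is only meaningful (capture-free) when `t` is
a term, and it is only used in that case. -/
def subst : PreFormula → ℕ → PreTerm → PreFormula
  | eq r s, i, t => eq (PreTerm.subst r i t) (PreTerm.subst s i t)
  | ne r s, i, t => ne (PreTerm.subst r i t) (PreTerm.subst s i t)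
  | le r s, i, t => le (PreTerm.subst r i t) (PreTerm.subst s i t)
  | nle r s, i, t => nle (PreTerm.subst r i t) (PreTerm.subst s i t)
  | and φ ψ, i, t => and (subst φ i t) (subst ψ i t)
  | or φ ψ, i, t => or (subst φ i t) (subst ψ i t)
  | all j φ, i, t => if i = 2 * j then all j φ else all j (subst φ i t)
  | ex j φ, i, t => if i = 2 * j then ex j φ else ex j (subst φ i t)

/-- `Sat η φ` means that the standard model `ℕ` satisfies `φ` under the assignment `η`. -/
def Sat : (ℕ → ℕ) → PreFormula → Prop
  | η, eq s t => s.val η = t.val η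
  | η, ne s t => s.val η ≠ t.val η
  | η, le s t => s.val η ≤ t.val η
  | η, nle s t => ¬ s.val η ≤ t.val η
  | η, and φ ψ => Sat η φ ∧ Sat η ψ
  | η, or φ ψ => Sat η φ ∨ Sat η ψ
  | η, all i φ => ∀ a : ℕ, Sat (Function.update η (2 * i) a) φ
  | η, ex i φ => ∃ a : ℕ, Sat (Function.update η (2 * i) a) φ

/-- The build-up of `Σ`-formulas: literals, closed under `∧`, `∨`, bounded quantification
`∀ x (x ≤ t → φ)` and `∃ x (x ≤ t ∧ φ)` with `x` not in `t`, and unbounded `∃ x`. -/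
inductive IsSigma : PreFormula → Prop
  | literal {φ : PreFormula} (h : IsLiteral φ) : IsSigma φ
  | and {φ ψ : PreFormula} (hφ : IsSigma φ) (hψ : IsSigma ψ) : IsSigma (and φ ψ)
  | or {φ ψ : PreFormula} (hφ : IsSigma φ) (hψ : IsSigma ψ) : IsSigma (or φ ψ)
  | ball {φ : PreFormula} (i : ℕ) (t : PreTerm) (ht : 2 * i ∉ t.FV) (hφ : IsSigma φ) :
      IsSigma (all i (imp (le (.var (2 * i)) t) φ))
  | bex {φ : PreFormula} (i : ℕ) (t : PreTerm) (ht : 2 * i ∉ t.FV) (hφ : IsSigma φ) :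
      IsSigma (ex i (PreFormula.and (le (.var (2 * i)) t) φ))
  | ex {φ : PreFormula} (i : ℕ) (hφ : IsSigma φ) : IsSigma (ex i φ)

/-- `φ` is `Π` if its negation is `Σ`. -/
def IsPi (φ : PreFormula) : Prop := IsSigma (neg φ)

end PreFormula

open PreFormula in
/-- A sequent is a finite set of formulas; it stands for their disjunction. -/
def IsSequent (Γ : Finset PreFormula) : Prop := ∀ φ ∈ Γ, IsFormula φ

open PreFormula in
/-- Derivability in the sequent calculus; `insert φ Γ` is the sequent `Γ, φ`. -/
inductive Derivable : Finset PreFormula → Prop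
  /-- `Γ` contains some literal and its negation. -/
  | ax {Γ : Finset PreFormula} (hΓ : IsSequent Γ) (φ : PreFormula) (hlit : IsLiteral φ)
      (h₁ : φ ∈ Γ) (h₂ : neg φ ∈ Γ) : Derivable Γ
  | and {Γ : Finset PreFormula} {φ ψ : PreFormula}
      (hΓ : IsSequent (insert (PreFormula.and φ ψ) Γ))
      (h₁ : Derivable (insert φ Γ)) (h₂ : Derivable (insert ψ Γ)) :
      Derivable (insert (PreFormula.and φ ψ) Γ)
  | or_left {Γ : Finset PreFormula} {φ ψ : PreFormula}
      (hΓ : IsSequent (insert (PreFormula.or φ ψ) Γ))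
      (h : Derivable (insert φ Γ)) : Derivable (insert (PreFormula.or φ ψ) Γ)
  | or_right {Γ : Finset PreFormula} {φ ψ : PreFormula}
      (hΓ : IsSequent (insert (PreFormula.or φ ψ) Γ))
      (h : Derivable (insert ψ Γ)) : Derivable (insert (PreFormula.or φ ψ) Γ)
  /-- From `⊢ Γ', φ[x/y]` infer `⊢ Γ, ∀ x φ`, for `Γ' ⊆ Γ` and an odd-indexed variable `y` that is
  not free in `Γ', ∀ x φ`. -/
  | all {Γ Γ' : Finset PreFormula} {i : ℕ} {φ : PreFormula}
      (hΓ : IsSequent (insert (PreFormula.all i φ) Γ)) (hsub : Γ' ⊆ Γ)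
      (y : ℕ) (hy : Odd y) (hfresh : ∀ θ ∈ insert (PreFormula.all i φ) Γ', y ∉ FV θ)
      (h : Derivable (insert (subst φ (2 * i) (.var y)) Γ')) :
      Derivable (insert (PreFormula.all i φ) Γ)
  | ex {Γ : Finset PreFormula} {i : ℕ} {φ : PreFormula}
      (hΓ : IsSequent (insert (PreFormula.ex i φ) Γ)) (t : PreTerm) (ht : t.IsTerm)
      (h : Derivable (insert (subst φ (2 * i) t) Γ)) : Derivable (insert (PreFormula.ex i φ) Γ)
  | cut {Γ : Finset PreFormula} (hΓ : IsSequent Γ) (φ : PreFormula) (hφ : IsFormula φ)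
      (h₁ : Derivable (insert φ Γ)) (h₂ : Derivable (insert (neg φ) Γ)) : Derivable Γ

open PreFormula in
/-- `Θ ⊢ φ`: the sequent `¬ θ₁, …, ¬ θₙ, φ` is derivable for some finite collection of `θᵢ ∈ Θ`. -/
def Provable (Θ : Set PreFormula) (φ : PreFormula) : Prop :=
  ∃ s : Finset PreFormula, (s : Set PreFormula) ⊆ Θ ∧ Derivable (insert φ (s.image neg))

/-- `Θ` is consistent if it does not prove falsity. -/
def Consistent (Θ : Set PreFormula) : Prop := ¬ Provable Θ PreFormula.falsum

/-- A theory is a set of sentences. -/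
def IsTheory (T : Set PreFormula) : Prop := ∀ θ ∈ T, PreFormula.IsSentence θ

open PreTerm PreFormula in
/-- The equality axioms for the signature of arithmetic, as sentences. In this and the next
definition the universal closures are taken with the bound variables `v₀, v₂, v₄, v₆`. -/
def equalityTheory : Set PreFormula :=
  let x := var 0
  let y := var 2
  let z := var 4
  let x₁ := var 0
  let y₁ := var 2
  let x₂ := var 4
  let y₂ := var 6
  { all 0 (eq x x),
    all 0 (all 1 (imp (eq x y) (eq y x))),
    all 0 (all 1 (all 2 (imp (and (eq x y) (eq y z)) (eq x z)))),
    -- compatibility with the function symbols `0, S, +, ×`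
    eq zero zero,
    all 0 (all 1 (imp (eq x y) (eq (succ x) (succ y)))),
    all 0 (all 1 (all 2 (all 3 (imp (and (eq x₁ y₁) (eq x₂ y₂))
      (eq (add x₁ x₂) (add y₁ y₂)))))),
    all 0 (all 1 (all 2 (all 3 (imp (and (eq x₁ y₁) (eq x₂ y₂))
      (eq (mul x₁ x₂) (mul y₁ y₂)))))),
    -- compatibility with the relation symbols `=, ≤`
    all 0 (all 1 (all 2 (all 3 (imp (and (eq x₁ y₁) (eq x₂ y₂))
      (iff (eq x₁ x₂) (eq y₁ y₂)))))),
    all 0 (all 1 (all 2 (all 3 (imp (and (eq x₁ y₁) (eq x₂ y₂))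
      (iff (le x₁ x₂) (le y₁ y₂)))))) }

open PreTerm PreFormula in
/-- Robinson arithmetic `Q`. -/
def robinsonQ : Set PreFormula :=
  let x := var 0
  let y := var 2
  let z := var 4
  equalityTheory ∪
  { all 0 (all 1 (imp (eq (succ x) (succ y)) (eq x y))),
    all 0 (iff (ne x zero) (ex 1 (eq x (succ y)))),
    all 0 (all 1 (iff (le x y) (ex 2 (eq (add z x) y)))),
    all 0 (eq (add x zero) x),
    all 0 (all 1 (eq (add x (succ y)) (succ (add x y)))),
    all 0 (eq (mul x zero) zero),
    all 0 (all 1 (eq (mul x (succ y)) (add (mul x y) x))) }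

/-- The Cantor pairing function. -/
def cantorPair (m n : ℕ) : ℕ := n + (m + n) * (m + n + 1) / 2

/-- The code of a finite sequence: `⟨⟩ = 0` and `⟨a₀, …, aₙ⟩ = π (⟨a₀, …, aₙ₋₁⟩, aₙ) + 1`. -/
def seqCode (l : List ℕ) : ℕ := l.foldl (fun c a => cantorPair c a + 1) 0

/-- The Gödel number of a pre-term. -/
def PreTerm.godelNum : PreTerm → ℕ
  | .var i => seqCode [0, 0, i]
  | .zero => seqCode [0, 1]
  | .succ t => seqCode [0, 2, godelNum t]
  | .add s t => seqCode [0, 3, godelNum s, godelNum t]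
  | .mul s t => seqCode [0, 4, godelNum s, godelNum t]

/-- The Gödel number of a pre-formula. -/
def PreFormula.godelNum : PreFormula → ℕ
  | .eq s t => seqCode [1, 0, s.godelNum, t.godelNum]
  | .ne s t => seqCode [1, 1, s.godelNum, t.godelNum]
  | .le s t => seqCode [1, 2, s.godelNum, t.godelNum]
  | .nle s t => seqCode [1, 3, s.godelNum, t.godelNum]
  | .and φ ψ => seqCode [1, 4, godelNum φ, godelNum ψ]
  | .or φ ψ => seqCode [1, 5, godelNum φ, godelNum ψ]
  | .all i φ => seqCode [1, 6, 2 * i, godelNum φ]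
  | .ex i φ => seqCode [1, 7, 2 * i, godelNum φ]

open PreFormula in
/-- A set `A` of natural numbers is `Σ`-definable if there is a `Σ`-formula `φ(x)` with at most the
free variable `x = vₖ` such that `a ∈ A` if and only if `ℕ ⊨ φ(a)`. -/
def SigmaDefinable (A : Set ℕ) : Prop :=
  ∃ (φ : PreFormula) (k : ℕ), IsFormula φ ∧ IsSigma φ ∧ FV φ ⊆ {k} ∧
    ∀ (a : ℕ) (η : ℕ → ℕ), η k = a → (a ∈ A ↔ Sat η φ)

end FOArith

/-!
Rosser's form of the first incompleteness theorem. For a consistent theory `T ⊇ Q` with a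
`Σ`-definable set of axioms consider the sets

* `A`, of the Gödel numbers `n = ⌜φ⌝` such that `T` proves `φ(n)`, and
* `B`, of the Gödel numbers `n = ⌜φ⌝` such that `T` proves `¬ φ(n)`.

Both are `Σ`-definable, as provability in `T` is, and they are disjoint, as `T` is consistent. By
Rosser's trick there is a `Σ`-formula `σ(x)` such that `Q` proves `σ(n)` for `n ∈ B` and `¬ σ(n)` for
`n ∈ A` (`exists_separating_formula`). Now let `n` be the Gödel number of `σ` itself. If `T` proves
`σ(n)`, then `n ∈ A`, so that `T` proves `¬ σ(n)`; and if `T` proves `¬ σ(n)`, then `n ∈ B`, so that `T`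
proves `σ(n)`. Hence `T` proves neither, and `¬ σ(n)` is the required `Π`-sentence. Choosing `n` as
the Gödel number of `σ` plays the role of the fixed point lemma.

*Proofs in `Q`.* No derivation in `Q` is written down. A Henkin construction shows that each
underivable sequent can be falsified (`exists_countermodel`), and so it suffices to check that a
sentence holds in all models of `Q` with true equality (`provable_of_models`). In such a model the
elements below a numeral are numerals, and every element is comparable with every numeral; hence
bounded formulas are absolute for numerals (`IsQModel.sat_iff_of_isBounded`), and true `Σ`-sentences
hold in the model (`IsQModel.sat_of_isSigma`).

*Definability.* Relations on natural numbers, terms, formulas, lists and tuples of these are treated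
uniformly, through a class `SigmaType` of types with a `Σ`-definable set of codes. A predicate is `Σ`
(`SigmaPred`) if its codes form a `Σ`-definable set, and a function is `Σ` (`SigmaFn`) if its graph is.
These notions have enough closure properties for `fun_prop` to verify most instances. The main one is
closure under inductive definitions (`SigmaPred.gen`), which rests on Gödel's `β`-function: an
element is generated by given rules if it is an entry of a finite sequence whose entries follow from
earlier ones. Recursive operations such as substitution are `Σ` because their graphs are inductively
defined, and so is derivability, by the rules of the sequent calculus (`SigmaPred.provable`).
-/

namespace FOArith

/-! ### Structures and substitution -/

/-- A structure for the signature `0, S, +, ×, =, ≤` with universe `M`; the relation interpreting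
the equality symbol is arbitrary. -/
structure ArithStr (M : Type) where
  zero : M
  succ : M → M
  add : M → M → M
  mul : M → M → M
  eq : M → M → Prop
  le : M → M → Prop

namespace ArithStr

variable {M : Type} (S : ArithStr M)

/-- The value of a pre-term in a structure under an assignment. -/
def val (η : ℕ → M) : PreTerm → M
  | .var i => η i
  | .zero => S.zero
  | .succ t => S.succ (val η t)
  | .add s t => S.add (val η s) (val η t)
  | .mul s t => S.mul (val η s) (val η t)

/-- Satisfaction of a pre-formula in a structure under an assignment. -/
def Sat : (ℕ → M) → PreFormula → Prop
  | η, .eq s t => S.eq (S.val η s) (S.val η t)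
  | η, .ne s t => ¬ S.eq (S.val η s) (S.val η t)
  | η, .le s t => S.le (S.val η s) (S.val η t)
  | η, .nle s t => ¬ S.le (S.val η s) (S.val η t)
  | η, .and φ ψ => Sat η φ ∧ Sat η ψ
  | η, .or φ ψ => Sat η φ ∨ Sat η ψ
  | η, .all i φ => ∀ a : M, Sat (Function.update η (2 * i) a) φ
  | η, .ex i φ => ∃ a : M, Sat (Function.update η (2 * i) a) φ

/-- The standard model of arithmetic. -/
def std : ArithStr ℕ := ⟨0, (· + 1), (· + ·), (· * ·), (· = ·), (· ≤ ·)⟩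

theorem std_eq (a b : ℕ) : std.eq a b ↔ a = b := Iff.rfl

theorem std_le (a b : ℕ) : std.le a b ↔ a ≤ b := Iff.rfl

theorem val_std (η : ℕ → ℕ) (t : PreTerm) : std.val η t = t.val η := by
  induction t <;> simp_all [val, PreTerm.val, std]

theorem sat_std (η : ℕ → ℕ) (φ : PreFormula) : std.Sat η φ ↔ φ.Sat η := by
  induction φ generalizing η <;> simp_all [Sat, PreFormula.Sat, val_std] <;> simp [std]

theorem sat_neg (η : ℕ → M) (φ : PreFormula) : S.Sat η φ.neg ↔ ¬ S.Sat η φ := by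
  induction φ generalizing η <;> simp_all [Sat, PreFormula.neg, imp_iff_not_or]

theorem sat_imp (η : ℕ → M) (φ ψ : PreFormula) :
    S.Sat η (φ.imp ψ) ↔ (S.Sat η φ → S.Sat η ψ) := by
  simp [PreFormula.imp, Sat, sat_neg, imp_iff_not_or]

theorem sat_iff (η : ℕ → M) (φ ψ : PreFormula) :
    S.Sat η (φ.iff ψ) ↔ (S.Sat η φ ↔ S.Sat η ψ) := by
  simp [PreFormula.iff, Sat, sat_imp, iff_iff_implies_and_implies]

theorem val_congr {η θ : ℕ → M} (t : PreTerm) (h : ∀ i ∈ t.FV, η i = θ i) :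
    S.val η t = S.val θ t := by
  induction t <;> simp_all [val, PreTerm.FV]

theorem sat_congr {η θ : ℕ → M} (φ : PreFormula) (h : ∀ i ∈ φ.FV, η i = θ i) :
    S.Sat η φ ↔ S.Sat θ φ := by
  induction φ generalizing η θ with
  | eq s t | ne s t | le s t | nle s t =>
    simp only [PreFormula.FV, Finset.mem_union] at h
    simp only [Sat, S.val_congr s fun i hi => h i (.inl hi),
      S.val_congr t fun i hi => h i (.inr hi)]
  | and φ ψ h1 h2 | or φ ψ h1 h2 =>
    simp only [PreFormula.FV, Finset.mem_union] at h
    simp only [Sat, h1 fun i hi => h i (.inl hi), h2 fun i hi => h i (.inr hi)]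
  | all j φ ih | ex j φ ih =>
    simp only [PreFormula.FV, Finset.mem_erase] at h
    simp only [Sat]
    first | apply forall_congr' | apply exists_congr
    intro a
    apply ih
    intro i hi
    by_cases hij : i = 2 * j
    · simp [hij]
    · simp [hij, h i ⟨hij, hi⟩]

end ArithStr

/-- The indices `i` such that a quantifier binding `v₂ᵢ` occurs in a pre-formula. -/
def PreFormula.BV : PreFormula → Finset ℕ
  | .eq _ _ | .ne _ _ | .le _ _ | .nle _ _ => ∅
  | .and φ ψ | .or φ ψ => BV φ ∪ BV ψ
  | .all i φ | .ex i φ => insert i (BV φ)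

namespace ArithStr

variable {M : Type} (S : ArithStr M)

theorem val_subst (η : ℕ → M) (s : PreTerm) (i : ℕ) (t : PreTerm) :
    S.val η (s.subst i t) = S.val (Function.update η i (S.val η t)) s := by
  induction s with
  | var j =>
    by_cases h : i = j
    · simp [val, PreTerm.subst, h]
    · simp [val, PreTerm.subst, h, Function.update_of_ne (Ne.symm h)]
  | _ => simp_all [val, PreTerm.subst]

theorem val_update_of_notMem {t : PreTerm} {i : ℕ} (h : i ∉ t.FV) (η : ℕ → M) (a : M) :
    S.val (Function.update η i a) t = S.val η t := by
  apply S.val_congr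
  intro j hj
  rw [Function.update_of_ne]
  rintro rfl
  exact h hj

/-- The substitution lemma, under the usual condition that no variable of `t` gets captured. -/
theorem sat_subst (η : ℕ → M) (φ : PreFormula) (i : ℕ) (t : PreTerm)
    (ht : ∀ j ∈ φ.BV, 2 * j ∉ t.FV) :
    S.Sat η (φ.subst i t) ↔ S.Sat (Function.update η i (S.val η t)) φ := by
  induction φ generalizing η with
  | eq _ _ | ne _ _ | le _ _ | nle _ _ => simp [Sat, PreFormula.subst, val_subst]
  | and φ ψ h1 h2 | or φ ψ h1 h2 =>
    simp only [PreFormula.BV, Finset.mem_union] at ht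
    simp only [Sat, PreFormula.subst, h1 η fun j hj => ht j (.inl hj),
      h2 η fun j hj => ht j (.inr hj)]
  | all j φ ih | ex j φ ih =>
    simp only [PreFormula.BV, Finset.mem_insert] at ht
    by_cases hij : i = 2 * j
    · simp [PreFormula.subst, hij, Sat]
    · simp only [PreFormula.subst, hij, if_false, Sat]
      first | apply forall_congr' | apply exists_congr
      intro a
      rw [ih _ fun k hk => ht k (.inr hk), S.val_update_of_notMem (ht j (.inl rfl)),
        Function.update_comm hij]

end ArithStr

theorem PreTerm.IsTerm.not_even_mem {t : PreTerm} (ht : t.IsTerm) (j : ℕ) : 2 * j ∉ t.FV := by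
  intro h
  have := ht _ h
  simp [← Nat.not_even_iff_odd] at this

namespace PreFormula

theorem neg_neg (φ : PreFormula) : φ.neg.neg = φ := by
  induction φ <;> simp_all [neg]

@[simp] theorem FV_neg (φ : PreFormula) : φ.neg.FV = φ.FV := by
  induction φ <;> simp_all [neg, FV]

theorem IsFormula.neg {φ : PreFormula} (h : φ.IsFormula) : φ.neg.IsFormula := by
  simpa [IsFormula] using h

theorem IsSentence.isFormula {φ : PreFormula} (h : φ.IsSentence) : φ.IsFormula := by
  simp [IsFormula, show φ.FV = ∅ from h]

theorem _root_.FOArith.PreTerm.FV_subst_subset (s : PreTerm) (i : ℕ) (t : PreTerm) :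
    (s.subst i t).FV ⊆ s.FV.erase i ∪ t.FV := by
  induction s with
  | var j =>
    by_cases h : i = j
    · simp [PreTerm.subst, h]
    · simp [PreTerm.subst, h, PreTerm.FV]
  | _ => simp_all [PreTerm.FV, PreTerm.subst] <;> grind

theorem FV_subst_subset (φ : PreFormula) (i : ℕ) (t : PreTerm) :
    (φ.subst i t).FV ⊆ φ.FV.erase i ∪ t.FV := by
  induction φ with
  | eq s u | ne s u | le s u | nle s u =>
    have h1 := s.FV_subst_subset i t
    have h2 := u.FV_subst_subset i t
    simp only [FV, subst]
    grind
  | and φ ψ | or φ ψ => simp only [FV, subst]; grind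
  | all j φ | ex j φ =>
    by_cases h : i = 2 * j
    · simp [subst, h, FV]
    · simp only [FV, subst, h, if_false]; grind

theorem IsFormula.subst {i : ℕ} {φ : PreFormula} {t : PreTerm} (h : (all i φ).IsFormula)
    (ht : t.IsTerm) : (φ.subst (2 * i) t).IsFormula := by
  intro j hj
  have := FV_subst_subset _ _ _ hj
  rcases Finset.mem_union.1 this with h' | h'
  · exact h j h'
  · exact ht j h'

end PreFormula

/-! ### Weakening -/

theorem Derivable.isSequent {Γ : Finset PreFormula} (h : Derivable Γ) : IsSequent Γ := by
  cases h <;> assumption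

/-- Weakening is admissible. No renaming of variables is needed, since the rule for `∀` already allows
side formulas that are not in the premise. -/
theorem Derivable.weaken {Γ Δ : Finset PreFormula} (h : Derivable Γ) (hs : Γ ⊆ Δ)
    (hΔ : IsSequent Δ) : Derivable Δ := by
  induction h generalizing Δ with
  | ax hΓ φ hlit h₁ h₂ => exact .ax hΔ φ hlit (hs h₁) (hs h₂)
  | @and Γ φ ψ hΓ h₁ h₂ ih₁ ih₂ =>
    have hm := hs (Finset.mem_insert_self _ _)
    have hs' := (Finset.subset_insert _ _).trans hs
    rw [← Finset.insert_eq_of_mem hm] at hΔ ⊢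
    refine .and hΔ (ih₁ (Finset.insert_subset_insert _ hs') ?_)
      (ih₂ (Finset.insert_subset_insert _ hs') ?_) <;>
    · intro θ hθ
      rcases Finset.mem_insert.1 hθ with rfl | hθ
      · exact fun j hj => hΔ _ (Finset.mem_insert_self _ _) j (by simp [PreFormula.FV, hj])
      · exact hΔ _ (Finset.mem_insert_of_mem hθ)
  | @or_left Γ φ ψ hΓ h ih =>
    have hm := hs (Finset.mem_insert_self _ _)
    have hs' := (Finset.subset_insert _ _).trans hs
    rw [← Finset.insert_eq_of_mem hm] at hΔ ⊢
    refine .or_left hΔ (ih (Finset.insert_subset_insert _ hs') ?_)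
    intro θ hθ
    rcases Finset.mem_insert.1 hθ with rfl | hθ
    · exact fun j hj => hΔ _ (Finset.mem_insert_self _ _) j (by simp [PreFormula.FV, hj])
    · exact hΔ _ (Finset.mem_insert_of_mem hθ)
  | @or_right Γ φ ψ hΓ h ih =>
    have hm := hs (Finset.mem_insert_self _ _)
    have hs' := (Finset.subset_insert _ _).trans hs
    rw [← Finset.insert_eq_of_mem hm] at hΔ ⊢
    refine .or_right hΔ (ih (Finset.insert_subset_insert _ hs') ?_)
    intro θ hθ
    rcases Finset.mem_insert.1 hθ with rfl | hθ
    · exact fun j hj => hΔ _ (Finset.mem_insert_self _ _) j (by simp [PreFormula.FV, hj])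
    · exact hΔ _ (Finset.mem_insert_of_mem hθ)
  | @all Γ Γ' i φ hΓ hsub y hy hfresh h ih =>
    have hm := hs (Finset.mem_insert_self _ _)
    have hs' := (Finset.subset_insert _ _).trans hs
    rw [← Finset.insert_eq_of_mem hm] at hΔ ⊢
    exact .all hΔ (hsub.trans hs') y hy hfresh h
  | @ex Γ i φ hΓ t ht h ih =>
    have hm := hs (Finset.mem_insert_self _ _)
    have hs' := (Finset.subset_insert _ _).trans hs
    rw [← Finset.insert_eq_of_mem hm] at hΔ ⊢
    refine .ex hΔ t ht (ih (Finset.insert_subset_insert _ hs') ?_)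
    intro θ hθ
    rcases Finset.mem_insert.1 hθ with rfl | hθ
    · have h' : (PreFormula.all i φ).IsFormula := hΔ (.ex i φ) (Finset.mem_insert_self _ _)
      exact h'.subst ht
    · exact hΔ _ (Finset.mem_insert_of_mem hθ)
  | @cut Γ hΓ φ hφ h₁ h₂ ih₁ ih₂ =>
    refine .cut hΔ φ hφ (ih₁ (Finset.insert_subset_insert _ hs) ?_)
      (ih₂ (Finset.insert_subset_insert _ hs) ?_) <;>
    · intro θ hθ
      rcases Finset.mem_insert.1 hθ with rfl | hθ
      · first | exact hφ | exact hφ.neg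
      · exact hΔ _ hθ

/-! ### Injectivity of Gödel numbers -/

theorem two_mul_cantorPair (m n : ℕ) :
    2 * cantorPair m n = 2 * n + (m + n) * (m + n + 1) := by
  rw [cantorPair, mul_add, Nat.mul_div_cancel' (Nat.even_mul_succ_self _).two_dvd]

theorem cantorPair_inj {a b c d : ℕ} : cantorPair a b = cantorPair c d ↔ a = c ∧ b = d := by
  -- The sum `m + n` can be recovered, since the pairs with a given sum form an interval.
  have key : ∀ {a b c d : ℕ}, a + b < c + d → cantorPair a b < cantorPair c d := by
    intro a b c d h
    have h1 := two_mul_cantorPair a b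
    have h2 := two_mul_cantorPair c d
    have h3 : (a + b + 1) * (a + b + 1 + 1) ≤ (c + d) * (c + d + 1) :=
      Nat.mul_le_mul h (Nat.succ_le_succ h)
    nlinarith
  refine ⟨fun h => ?_, fun ⟨h1, h2⟩ => by rw [h1, h2]⟩
  rcases lt_trichotomy (a + b) (c + d) with h' | h' | h'
  · exact absurd h (key h').ne
  · simp only [cantorPair, h'] at h
    omega
  · exact absurd h (key h').ne'

theorem le_cantorPair_left (m n : ℕ) : m ≤ cantorPair m n := by
  have := two_mul_cantorPair m n
  rcases m with _ | m
  · simp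
  · nlinarith

theorem le_cantorPair_right (m n : ℕ) : n ≤ cantorPair m n := Nat.le_add_right _ _

theorem PreTerm.godelNum_injective : Function.Injective PreTerm.godelNum := by
  intro s
  induction s <;> intro t h <;> cases t <;>
    simp_all [PreTerm.godelNum, seqCode, cantorPair_inj] <;> grind

theorem PreFormula.godelNum_injective : Function.Injective PreFormula.godelNum := by
  intro φ
  induction φ <;> intro ψ h <;> cases ψ <;>
    simp_all [PreFormula.godelNum, seqCode, cantorPair_inj, PreTerm.godelNum_injective.eq_iff] <;>
    grind

instance : Countable PreFormula := PreFormula.godelNum_injective.countable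

/-! ### Completeness of the sequent calculus -/

open PreFormula hiding Sat

/-- One step of the Henkin construction: either `φ` cannot be added to the underivable sequent `Γ`,
or it is added, together with a witness if it is universal. -/
theorem exists_henkin_step {Γ : Finset PreFormula} (hΓ : IsSequent Γ) (hd : ¬ Derivable Γ)
    (φ : PreFormula) : ∃ Δ : Finset PreFormula, Γ ⊆ Δ ∧ IsSequent Δ ∧ ¬ Derivable Δ ∧
      (φ.IsFormula → Derivable (insert φ Γ) ∨
        (φ ∈ Δ ∧ ∀ i χ, φ = all i χ → ∃ t, t.IsTerm ∧ χ.subst (2 * i) t ∈ Δ)) := by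
  by_cases h : φ.IsFormula ∧ ¬ Derivable (insert φ Γ)
  swap
  · exact ⟨Γ, subset_rfl, hΓ, hd, fun hφ => .inl (by tauto)⟩
  obtain ⟨hφ, hd'⟩ := h
  have hs : IsSequent (insert φ Γ) := by
    intro θ hθ
    rcases Finset.mem_insert.1 hθ with rfl | hθ
    exacts [hφ, hΓ θ hθ]
  by_cases hall : ∃ i χ, φ = all i χ
  · obtain ⟨i, χ, rfl⟩ := hall
    let y := 2 * ((insert (all i χ) Γ).sup fun θ => θ.FV.sup id) + 1
    have hy : Odd y := odd_two_mul_add_one _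
    have hyt : (PreTerm.var y).IsTerm := by simpa [PreTerm.IsTerm, PreTerm.FV] using hy
    have hfresh : ∀ θ ∈ insert (all i χ) Γ, y ∉ FV θ := by
      intro θ hθ hmem
      have h1 : y ≤ θ.FV.sup id := Finset.le_sup (f := id) hmem
      have h2 := Finset.le_sup (f := fun θ : PreFormula => θ.FV.sup id) hθ
      grind
    refine ⟨insert (χ.subst (2 * i) (.var y)) (insert (all i χ) Γ), ?_, ?_, ?_, ?_⟩
    · exact (Finset.subset_insert _ _).trans (Finset.subset_insert _ _)
    · intro θ hθ
      rcases Finset.mem_insert.1 hθ with rfl | hθ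
      exacts [hφ.subst hyt, hs θ hθ]
    · intro hd2
      apply hd'
      have := Derivable.all (Γ := insert (all i χ) Γ) (by simpa using hs) subset_rfl y hy
        (by simpa using hfresh) hd2
      simpa using this
    · intro _
      refine .inr ⟨by simp, ?_⟩
      rintro j χ' h
      obtain ⟨rfl, rfl⟩ := PreFormula.all.inj h
      exact ⟨_, hyt, by simp⟩
  · exact ⟨insert φ Γ, Finset.subset_insert _ _, hs, hd', fun _ =>
      .inr ⟨by simp, fun i χ h => (hall ⟨i, χ, h⟩).elim⟩⟩

/-- An underivable sequent extends to a maximal set of formulas that has no derivable finite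
subset and contains a witness for each of its universal formulas. -/
theorem exists_henkin_set {Γ : Finset PreFormula} (hΓ : IsSequent Γ) (hd : ¬ Derivable Γ) :
    ∃ H : Set PreFormula, ↑Γ ⊆ H ∧ (∀ φ ∈ H, φ.IsFormula) ∧
      (∀ Δ : Finset PreFormula, ↑Δ ⊆ H → ¬ Derivable Δ) ∧
      (∀ φ : PreFormula, φ.IsFormula → φ ∉ H →
        ∃ Δ : Finset PreFormula, ↑Δ ⊆ H ∧ Derivable (insert φ Δ)) ∧
      (∀ i χ, all i χ ∈ H → ∃ t, t.IsTerm ∧ χ.subst (2 * i) t ∈ H) := by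
  have : Nonempty PreFormula := ⟨falsum⟩
  obtain ⟨e, he⟩ := exists_surjective_nat PreFormula
  let U := {Δ : Finset PreFormula // IsSequent Δ ∧ ¬ Derivable Δ}
  have hstep : ∀ (Δ : U) (φ : PreFormula), ∃ Δ' : U, Δ.1 ⊆ Δ'.1 ∧
      (φ.IsFormula → Derivable (insert φ Δ.1) ∨
        (φ ∈ Δ'.1 ∧ ∀ i χ, φ = all i χ → ∃ t, t.IsTerm ∧ χ.subst (2 * i) t ∈ Δ'.1)) := by
    rintro ⟨Δ, h1, h2⟩ φ
    obtain ⟨Δ', h3, h4, h5, h6⟩ := exists_henkin_step h1 h2 φ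
    exact ⟨⟨Δ', h4, h5⟩, h3, h6⟩
  choose next hsub hnext using hstep
  -- Every formula is treated at some stage, and `H` is the union of all stages.
  let G : ℕ → U := fun n => Nat.rec ⟨Γ, hΓ, hd⟩ (fun n Δ => next Δ (e n)) n
  have hG : ∀ n, G (n + 1) = next (G n) (e n) := fun n => rfl
  have hmono : Monotone fun n => (G n).1 := monotone_nat_of_le_succ fun n => hsub _ _
  have hfin : ∀ Δ : Finset PreFormula, (↑Δ ⊆ ⋃ n, ((G n).1 : Set PreFormula)) →
      ∃ n, Δ ⊆ (G n).1 := by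
    intro Δ
    induction Δ using Finset.induction_on with
    | empty => exact fun _ => ⟨0, by simp⟩
    | insert φ Δ _ ih =>
      intro h
      rw [Finset.coe_insert, Set.insert_subset_iff] at h
      obtain ⟨n, hn⟩ := ih h.2
      obtain ⟨m, hm⟩ := Set.mem_iUnion.1 h.1
      exact ⟨max m n, Finset.insert_subset (hmono (le_max_left m n) hm)
        (hn.trans (hmono (le_max_right m n)))⟩
  have hund : ∀ Δ : Finset PreFormula, (↑Δ ⊆ ⋃ n, ((G n).1 : Set PreFormula)) →
      ¬ Derivable Δ := by
    intro Δ hΔ h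
    obtain ⟨n, hn⟩ := hfin Δ hΔ
    exact (G n).2.2 (h.weaken hn (G n).2.1)
  refine ⟨⋃ n, ((G n).1 : Set PreFormula),
    Set.subset_iUnion (fun n => ((G n).1 : Set PreFormula)) 0, ?_, hund, ?_, ?_⟩
  · intro φ hφ
    obtain ⟨n, hn⟩ := Set.mem_iUnion.1 hφ
    exact (G n).2.1 φ hn
  · intro φ hf hφ
    obtain ⟨n, rfl⟩ := he φ
    rcases hnext (G n) (e n) hf with h | h
    · exact ⟨(G n).1, Set.subset_iUnion (fun n => ((G n).1 : Set PreFormula)) n, h⟩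
    · exact (hφ (Set.mem_iUnion.2 ⟨n + 1, h.1⟩)).elim
  · intro i χ h
    obtain ⟨n, hn⟩ := he (all i χ)
    obtain ⟨m, hm⟩ := Set.mem_iUnion.1 h
    rcases hnext (G n) (e n) (hn ▸ (G m).2.1 _ hm) with h' | h'
    · rw [hn] at h'
      refine (hund _ ?_ h').elim
      rw [Finset.coe_insert]
      exact Set.insert_subset h (Set.subset_iUnion (fun n => ((G n).1 : Set PreFormula)) n)
    · obtain ⟨t, ht, hmem⟩ := h'.2 i χ hn
      exact ⟨t, ht, Set.mem_iUnion.2 ⟨n + 1, hmem⟩⟩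

/-- The number of connectives and quantifiers of a pre-formula. -/
def PreFormula.depth : PreFormula → ℕ
  | .eq _ _ | .ne _ _ | .le _ _ | .nle _ _ => 0
  | .and φ ψ | .or φ ψ => depth φ + depth ψ + 1
  | .all _ φ | .ex _ φ => depth φ + 1

theorem PreFormula.depth_subst (φ : PreFormula) (i : ℕ) (t : PreTerm) :
    (φ.subst i t).depth = φ.depth := by
  induction φ with
  | all j φ | ex j φ => by_cases h : i = 2 * j <;> simp_all [subst, depth]
  | _ => simp_all [subst, depth]

/-- The structure on the set of terms in which an atomic formula holds if it is not in `H`. -/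
def termModel (H : Set PreFormula) : ArithStr {t : PreTerm // t.IsTerm} where
  zero := ⟨.zero, by simp [PreTerm.IsTerm, PreTerm.FV]⟩
  succ t := ⟨.succ t.1, t.2⟩
  add s t := ⟨.add s.1 t.1, fun j hj => (Finset.mem_union.1 hj).elim (s.2 j) (t.2 j)⟩
  mul s t := ⟨.mul s.1 t.1, fun j hj => (Finset.mem_union.1 hj).elim (s.2 j) (t.2 j)⟩
  eq s t := .eq s.1 t.1 ∉ H
  le s t := .le s.1 t.1 ∉ H

/-- The assignment sending each variable of odd index to itself. The values of the variables of even
index are immaterial, as these do not occur freely in formulas. -/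
def termAssignment (i : ℕ) : {t : PreTerm // t.IsTerm} :=
  if h : Odd i then ⟨.var i, by simpa [PreTerm.IsTerm, PreTerm.FV] using h⟩
  else ⟨.zero, by simp [PreTerm.IsTerm, PreTerm.FV]⟩

theorem termModel_val (H : Set PreFormula) (t : PreTerm) (ht : t.IsTerm) :
    (termModel H).val termAssignment t = ⟨t, ht⟩ := by
  induction t with
  | var i =>
    have : Odd i := ht i (by simp [PreTerm.FV])
    simp [ArithStr.val, termAssignment, this]
  | zero => rfl
  | succ t ih => exact congrArg (termModel H).succ (ih ht)
  | add s t h1 h2 =>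
    exact congrArg₂ (termModel H).add (h1 fun j hj => ht j (by simp [PreTerm.FV, hj]))
      (h2 fun j hj => ht j (by simp [PreTerm.FV, hj]))
  | mul s t h1 h2 =>
    exact congrArg₂ (termModel H).mul (h1 fun j hj => ht j (by simp [PreTerm.FV, hj]))
      (h2 fun j hj => ht j (by simp [PreTerm.FV, hj]))

theorem termModel_sat_eq (H : Set PreFormula) {s t : PreTerm} (h : (eq s t).IsFormula) :
    (termModel H).Sat termAssignment (.eq s t) ↔ .eq s t ∉ H := by
  have hs : s.IsTerm := fun j hj => h j (by simp [FV, hj])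
  have ht : t.IsTerm := fun j hj => h j (by simp [FV, hj])
  simp only [ArithStr.Sat, termModel_val H s hs, termModel_val H t ht]
  rfl

theorem termModel_sat_le (H : Set PreFormula) {s t : PreTerm} (h : (le s t).IsFormula) :
    (termModel H).Sat termAssignment (.le s t) ↔ .le s t ∉ H := by
  have hs : s.IsTerm := fun j hj => h j (by simp [FV, hj])
  have ht : t.IsTerm := fun j hj => h j (by simp [FV, hj])
  simp only [ArithStr.Sat, termModel_val H s hs, termModel_val H t ht]
  rfl

/-- An underivable sequent can be falsified. -/
theorem exists_countermodel {Γ : Finset PreFormula} (hΓ : IsSequent Γ) (hd : ¬ Derivable Γ) :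
    ∃ (M : Type) (S : ArithStr M) (η : ℕ → M), ∀ φ ∈ Γ, ¬ S.Sat η φ := by
  obtain ⟨H, hsub, hform, hund, hmax, hwit⟩ := exists_henkin_set hΓ hd
  refine ⟨_, termModel H, termAssignment, fun φ hφ => ?_⟩
  have hseq : ∀ {Δ : Finset PreFormula}, ↑Δ ⊆ H → IsSequent Δ := fun h φ hφ => hform φ (h hφ)
  -- All formulas in `H` are false, by induction on their depth: those of smaller depth that are true
  -- are not in `H`, and hence derivable from finitely many elements of `H` by maximality.
  suffices ∀ n φ, φ.depth < n → φ ∈ H → ¬ (termModel H).Sat termAssignment φ from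
    this _ φ (Nat.lt_succ_self _) (hsub hφ)
  intro n
  induction n with
  | zero => intro φ h; exact absurd h (Nat.not_lt_zero _)
  | succ n ih =>
    intro φ hlt hφ
    cases φ with
    | eq s t => rwa [termModel_sat_eq H (hform _ hφ), not_not]
    | le s t => rwa [termModel_sat_le H (hform _ hφ), not_not]
    | ne s t =>
      have hf : (eq s t).IsFormula := hform (ne s t) hφ
      intro h
      have h := mt (termModel_sat_eq H hf).2 h
      rw [not_not] at h
      have hΔ : (({.eq s t, .ne s t} : Finset PreFormula) : Set PreFormula) ⊆ H := by
        simp [Set.insert_subset_iff, h, hφ]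
      exact hund _ hΔ (.ax (hseq hΔ) (.eq s t) trivial (by simp) (by simp [neg]))
    | nle s t =>
      have hf : (le s t).IsFormula := hform (nle s t) hφ
      intro h
      have h := mt (termModel_sat_le H hf).2 h
      rw [not_not] at h
      have hΔ : (({.le s t, .nle s t} : Finset PreFormula) : Set PreFormula) ⊆ H := by
        simp [Set.insert_subset_iff, h, hφ]
      exact hund _ hΔ (.ax (hseq hΔ) (.le s t) trivial (by simp) (by simp [neg]))
    | and φ ψ =>
      have hf := hform _ hφ
      have hf1 : φ.IsFormula := fun j hj => hf j (by simp [FV, hj])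
      have hf2 : ψ.IsFormula := fun j hj => hf j (by simp [FV, hj])
      rintro ⟨h1, h2⟩
      obtain ⟨Δ₁, hΔ₁, hd₁⟩ := hmax φ hf1 fun h => ih φ (by simp [depth] at hlt; omega) h h1
      obtain ⟨Δ₂, hΔ₂, hd₂⟩ := hmax ψ hf2 fun h => ih ψ (by simp [depth] at hlt; omega) h h2
      have hΔ : ((insert (.and φ ψ) (Δ₁ ∪ Δ₂) : Finset PreFormula) : Set PreFormula) ⊆ H := by
        simp [Set.insert_subset_iff, hφ, hΔ₁, hΔ₂]
      have hΔ' : ((Δ₁ ∪ Δ₂ : Finset PreFormula) : Set PreFormula) ⊆ H := by simp [hΔ₁, hΔ₂]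
      refine hund _ hΔ (.and (hseq hΔ) (hd₁.weaken ?_ ?_) (hd₂.weaken ?_ ?_))
      · exact Finset.insert_subset_insert _ Finset.subset_union_left
      · intro θ hθ
        rcases Finset.mem_insert.1 hθ with rfl | hθ
        exacts [hf1, hseq hΔ' θ hθ]
      · exact Finset.insert_subset_insert _ Finset.subset_union_right
      · intro θ hθ
        rcases Finset.mem_insert.1 hθ with rfl | hθ
        exacts [hf2, hseq hΔ' θ hθ]
    | or φ ψ =>
      have hf := hform _ hφ
      have hf1 : φ.IsFormula := fun j hj => hf j (by simp [FV, hj])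
      have hf2 : ψ.IsFormula := fun j hj => hf j (by simp [FV, hj])
      rintro (h1 | h2)
      · obtain ⟨Δ, hΔ, hd⟩ := hmax φ hf1 fun h => ih φ (by simp [depth] at hlt; omega) h h1
        have hΔ' : ((insert (.or φ ψ) Δ : Finset PreFormula) : Set PreFormula) ⊆ H := by
          simp [Set.insert_subset_iff, hφ, hΔ]
        exact hund _ hΔ' (.or_left (hseq hΔ') hd)
      · obtain ⟨Δ, hΔ, hd⟩ := hmax ψ hf2 fun h => ih ψ (by simp [depth] at hlt; omega) h h2
        have hΔ' : ((insert (.or φ ψ) Δ : Finset PreFormula) : Set PreFormula) ⊆ H := by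
          simp [Set.insert_subset_iff, hφ, hΔ]
        exact hund _ hΔ' (.or_right (hseq hΔ') hd)
    | all i χ =>
      obtain ⟨t, ht, hmem⟩ := hwit i χ hφ
      intro h
      apply ih _ _ hmem
      · rw [ArithStr.sat_subst _ _ _ _ _ fun j _ => ht.not_even_mem j]
        exact h _
      · rw [depth_subst]; simp [depth] at hlt; omega
    | ex i χ =>
      rintro ⟨⟨t, ht⟩, h⟩
      have hf : (χ.subst (2 * i) t).IsFormula := by
        have hf : (PreFormula.all i χ).IsFormula := hform (.ex i χ) hφ
        exact hf.subst ht
      have hnot : χ.subst (2 * i) t ∉ H := fun hmem => by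
        apply ih _ _ hmem
        · rw [ArithStr.sat_subst _ _ _ _ _ fun j _ => ht.not_even_mem j, termModel_val H t ht]
          exact h
        · rw [depth_subst]; simp [depth] at hlt; omega
      obtain ⟨Δ, hΔ, hd⟩ := hmax _ hf hnot
      have hΔ' : ((insert (.ex i χ) Δ : Finset PreFormula) : Set PreFormula) ⊆ H := by
        simp [Set.insert_subset_iff, hφ, hΔ]
      exact hund _ hΔ' (.ex (hseq hΔ') t ht hd)

/-! ### Models of Robinson arithmetic -/

/-- A model of Robinson arithmetic in which the equality symbol is interpreted by equality. -/
structure IsQModel {M : Type} (S : ArithStr M) : Prop where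
  eq_iff : ∀ a b, S.eq a b ↔ a = b
  succ_inj : ∀ a b, S.succ a = S.succ b → a = b
  ne_zero_iff : ∀ a, a ≠ S.zero ↔ ∃ b, a = S.succ b
  le_iff : ∀ a b, S.le a b ↔ ∃ c, S.add c a = b
  add_zero : ∀ a, S.add a S.zero = a
  add_succ : ∀ a b, S.add a (S.succ b) = S.succ (S.add a b)
  mul_zero : ∀ a, S.mul a S.zero = S.zero
  mul_succ : ∀ a b, S.mul a (S.succ b) = S.add (S.mul a b) a

/-- The value of the numeral for `n`. -/
def ArithStr.num {M : Type} (S : ArithStr M) : ℕ → M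
  | 0 => S.zero
  | n + 1 => S.succ (num S n)

open PreTerm hiding val
open ArithStr (Sat val std num sat_imp sat_iff sat_neg val_std val_update_of_notMem)

/-- Dividing a structure satisfying the equality axioms by the interpretation of the equality
symbol yields a structure with true equality that satisfies the same formulas. -/
theorem exists_quotient {M : Type} (S : ArithStr M)
    (h : ∀ θ ∈ equalityTheory, ∀ η, S.Sat η θ) :
    ∃ (N : Type) (S' : ArithStr N) (q : M → N), (∀ a b, S'.eq a b ↔ a = b) ∧
      ∀ η φ, S'.Sat (q ∘ η) φ ↔ S.Sat η φ := by
  let η₀ : ℕ → M := fun _ => S.zero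
  have hrefl : ∀ a, S.eq a a := by
    simpa [Sat, val] using h (all 0 (eq (var 0) (var 0))) (by simp [equalityTheory]) η₀
  have hsymm : ∀ a b, S.eq a b → S.eq b a := by
    simpa [Sat, val, sat_imp] using h (all 0 (all 1 (imp (eq (var 0) (var 2))
      (eq (var 2) (var 0))))) (by simp [equalityTheory]) η₀
  have htrans : ∀ a b c, S.eq a b → S.eq b c → S.eq a c := by
    simpa [Sat, val, sat_imp] using h (all 0 (all 1 (all 2 (imp (and (eq (var 0) (var 2))
      (eq (var 2) (var 4))) (eq (var 0) (var 4)))))) (by simp [equalityTheory]) η₀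
  have hsucc : ∀ a b, S.eq a b → S.eq (S.succ a) (S.succ b) := by
    simpa [Sat, val, sat_imp] using h (all 0 (all 1 (imp (eq (var 0) (var 2))
      (eq (succ (var 0)) (succ (var 2)))))) (by simp [equalityTheory]) η₀
  have hadd : ∀ a b c d, S.eq a b → S.eq c d → S.eq (S.add a c) (S.add b d) := by
    simpa [Sat, val, sat_imp] using h (all 0 (all 1 (all 2 (all 3 (imp (and (eq (var 0) (var 2))
      (eq (var 4) (var 6))) (eq (add (var 0) (var 4)) (add (var 2) (var 6))))))))
      (by simp [equalityTheory]) η₀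
  have hmul : ∀ a b c d, S.eq a b → S.eq c d → S.eq (S.mul a c) (S.mul b d) := by
    simpa [Sat, val, sat_imp] using h (all 0 (all 1 (all 2 (all 3 (imp (and (eq (var 0) (var 2))
      (eq (var 4) (var 6))) (eq (mul (var 0) (var 4)) (mul (var 2) (var 6))))))))
      (by simp [equalityTheory]) η₀
  have hle : ∀ a b c d, S.eq a b → S.eq c d → (S.le a c ↔ S.le b d) := by
    simpa [Sat, val, sat_imp, sat_iff] using h (all 0 (all 1 (all 2 (all 3 (imp
      (and (eq (var 0) (var 2)) (eq (var 4) (var 6)))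
      (iff (le (var 0) (var 4)) (le (var 2) (var 6)))))))) (by simp [equalityTheory]) η₀
  let s : Setoid M := ⟨S.eq, hrefl, fun {a b} => hsymm a b, fun {a b c} => htrans a b c⟩
  let S' : ArithStr (Quotient s) :=
    { zero := ⟦S.zero⟧
      succ := Quotient.map S.succ fun a b => hsucc a b
      add := Quotient.map₂ S.add fun a b hab c d hcd => hadd a b c d hab hcd
      mul := Quotient.map₂ S.mul fun a b hab c d hcd => hmul a b c d hab hcd
      eq := Eq
      le := Quotient.lift₂ S.le fun a b c d hac hbd => propext (hle a c b d hac hbd) }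
  let q : M → Quotient s := fun a => ⟦a⟧
  have hval : ∀ (η : ℕ → M) (t : PreTerm), S'.val (q ∘ η) t = q (S.val η t) := by
    intro η t
    induction t with
    | var i => rfl
    | zero => rfl
    | succ t ih => simp only [val, ih]; rfl
    | add s t h1 h2 | mul s t h1 h2 => simp only [val, h1, h2]; rfl
  have heq : ∀ a b, S'.eq (q a) (q b) ↔ S.eq a b := fun a b => Quotient.eq (r := s)
  have hle' : ∀ a b, S'.le (q a) (q b) ↔ S.le a b := fun a b => Iff.rfl
  have hsurj : Function.Surjective q := Quotient.mk_surjective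
  refine ⟨_, S', q, fun a b => Iff.rfl, fun η φ => ?_⟩
  induction φ generalizing η with
  | eq s t | ne s t | le s t | nle s t => simp only [Sat, hval, heq, hle']
  | and φ ψ h1 h2 | or φ ψ h1 h2 => simp only [Sat, h1, h2]
  | all i φ ih => simp only [Sat, hsurj.forall, ← Function.comp_update, ih]
  | ex i φ ih => simp only [Sat, hsurj.exists, ← Function.comp_update, ih]

theorem isQModel_of_sat {M : Type} {S : ArithStr M} (heq : ∀ a b, S.eq a b ↔ a = b)
    (h : ∀ θ ∈ robinsonQ, ∀ η, S.Sat η θ) : IsQModel S := by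
  let η₀ : ℕ → M := fun _ => S.zero
  refine ⟨heq, ?_, ?_, ?_, ?_, ?_, ?_, ?_⟩
  · simpa [Sat, val, sat_imp, heq] using h (all 0 (all 1 (imp (eq (succ (var 0)) (succ (var 2)))
      (eq (var 0) (var 2))))) (by simp [robinsonQ]) η₀
  · simpa [Sat, val, sat_iff, heq] using h (all 0 (PreFormula.iff (ne (var 0) zero)
      (ex 1 (eq (var 0) (succ (var 2)))))) (by simp [robinsonQ]) η₀
  · simpa [Sat, val, sat_iff, heq] using h (all 0 (all 1 (PreFormula.iff (le (var 0) (var 2))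
      (ex 2 (eq (add (var 4) (var 0)) (var 2)))))) (by simp [robinsonQ]) η₀
  · simpa [Sat, val, heq] using h (all 0 (eq (add (var 0) zero) (var 0))) (by simp [robinsonQ]) η₀
  · simpa [Sat, val, heq] using h (all 0 (all 1 (eq (add (var 0) (succ (var 2)))
      (succ (add (var 0) (var 2)))))) (by simp [robinsonQ]) η₀
  · simpa [Sat, val, heq] using h (all 0 (eq (mul (var 0) zero) zero)) (by simp [robinsonQ]) η₀
  · simpa [Sat, val, heq] using h (all 0 (all 1 (eq (mul (var 0) (succ (var 2)))
      (add (mul (var 0) (var 2)) (var 0))))) (by simp [robinsonQ]) η₀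

theorem robinsonQ_finite : robinsonQ.Finite := by
  simp [robinsonQ, equalityTheory]

/-- Completeness, for extensions of Robinson arithmetic. -/
theorem provable_of_models {T : Set PreFormula} (hT : IsTheory T) (hQ : robinsonQ ⊆ T)
    {φ : PreFormula} (hφ : φ.IsSentence)
    (h : ∀ (M : Type) (S : ArithStr M), IsQModel S → ∀ η, S.Sat η φ) : Provable T φ := by
  refine ⟨robinsonQ_finite.toFinset, by simpa using hQ, ?_⟩
  by_contra hd
  have hs : IsSequent (insert φ (robinsonQ_finite.toFinset.image neg)) := by
    intro θ hθ
    simp only [Finset.mem_insert, Finset.mem_image, Set.Finite.mem_toFinset] at hθ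
    rcases hθ with rfl | ⟨θ, hθ, rfl⟩
    exacts [hφ.isFormula, (hT θ (hQ hθ)).isFormula.neg]
  obtain ⟨M, S, η, hS⟩ := exists_countermodel hs hd
  have hS' : ∀ θ ∈ robinsonQ, ∀ η, S.Sat η θ := by
    intro θ hθ η'
    have := hS θ.neg (by
      simp only [Finset.mem_insert, Finset.mem_image, Set.Finite.mem_toFinset]
      exact .inr ⟨θ, hθ, rfl⟩)
    rw [sat_neg, not_not] at this
    refine (S.sat_congr θ fun i hi => ?_).1 this
    rw [show θ.FV = ∅ from hT θ (hQ hθ)] at hi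
    exact absurd hi (Finset.notMem_empty i)
  obtain ⟨N, S', q, heq, hq⟩ := exists_quotient S fun θ hθ => hS' θ (.inl hθ)
  have hM : IsQModel S' := by
    refine isQModel_of_sat heq fun θ hθ η' => ?_
    have h1 := (hq η θ).2 (hS' θ hθ η)
    refine (S'.sat_congr θ fun i hi => ?_).1 h1
    rw [show θ.FV = ∅ from hT θ (hQ hθ)] at hi
    exact absurd hi (Finset.notMem_empty i)
  exact hS φ (Finset.mem_insert_self _ _) ((hq η φ).1 (h N S' hM (q ∘ η)))

namespace IsQModel

variable {M : Type} {S : ArithStr M} (hS : IsQModel S)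
include hS

theorem succ_ne_zero (a : M) : S.succ a ≠ S.zero := (hS.ne_zero_iff _).2 ⟨a, rfl⟩

theorem num_inj {m n : ℕ} : S.num m = S.num n ↔ m = n := by
  refine ⟨fun h => ?_, fun h => by rw [h]⟩
  induction m generalizing n with
  | zero =>
    cases n with
    | zero => rfl
    | succ n => exact absurd h.symm (hS.succ_ne_zero _)
  | succ m ih =>
    cases n with
    | zero => exact absurd h (hS.succ_ne_zero _)
    | succ n => rw [ih (hS.succ_inj _ _ h)]

theorem add_num (m n : ℕ) : S.add (S.num m) (S.num n) = S.num (m + n) := by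
  induction n with
  | zero => exact hS.add_zero _
  | succ n ih => rw [num, hS.add_succ, ih]; rfl

theorem mul_num (m n : ℕ) : S.mul (S.num m) (S.num n) = S.num (m * n) := by
  induction n with
  | zero => exact hS.mul_zero _
  | succ n ih => rw [num, hS.mul_succ, ih, hS.add_num]; rfl

theorem val_num (η : ℕ → ℕ) (t : PreTerm) : S.val (S.num ∘ η) t = S.num (t.val η) := by
  induction t with
  | var i => rfl
  | zero => rfl
  | succ t ih => simp only [ArithStr.val, ih]; rfl
  | add s t h1 h2 => simp only [ArithStr.val, h1, h2, hS.add_num]; rfl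
  | mul s t h1 h2 => simp only [ArithStr.val, h1, h2, hS.mul_num]; rfl

/-- Robinson arithmetic proves `x ≤ n ↔ x = 0 ∨ … ∨ x = n` for each numeral `n`. -/
theorem le_num_iff {a : M} {n : ℕ} : S.le a (S.num n) ↔ ∃ k ≤ n, a = S.num k := by
  constructor
  · intro h
    obtain ⟨c, hc⟩ := (hS.le_iff _ _).1 h
    clear h
    induction n generalizing a with
    | zero =>
      by_cases ha : a = S.zero
      · exact ⟨0, le_rfl, ha⟩
      · obtain ⟨b, rfl⟩ := (hS.ne_zero_iff a).1 ha
        rw [hS.add_succ] at hc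
        exact absurd hc (hS.succ_ne_zero _)
    | succ n ih =>
      by_cases ha : a = S.zero
      · exact ⟨0, Nat.zero_le _, ha⟩
      · obtain ⟨b, rfl⟩ := (hS.ne_zero_iff a).1 ha
        rw [hS.add_succ] at hc
        obtain ⟨k, hk, rfl⟩ := ih (hS.succ_inj _ _ hc)
        exact ⟨k + 1, Nat.succ_le_succ hk, rfl⟩
  · rintro ⟨k, hk, rfl⟩
    refine (hS.le_iff _ _).2 ⟨S.num (n - k), ?_⟩
    rw [hS.add_num, Nat.sub_add_cancel hk]

theorem num_le_num {m n : ℕ} : S.le (S.num m) (S.num n) ↔ m ≤ n := by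
  rw [hS.le_num_iff]
  constructor
  · rintro ⟨k, hk, h⟩
    rwa [hS.num_inj.1 h]
  · exact fun h => ⟨m, h, rfl⟩

/-- For standard `n`, Robinson arithmetic proves `S x + n = x + S n`. -/
theorem succ_add_num (a : M) (n : ℕ) : S.add (S.succ a) (S.num n) = S.add a (S.num (n + 1)) := by
  induction n with
  | zero => rw [num, num, num, hS.add_succ, hS.add_zero, hS.add_zero]
  | succ n ih =>
    rw [num, hS.add_succ, ih]
    exact (hS.add_succ a (S.num (n + 1))).symm

/-- Every element of a model of Robinson arithmetic is comparable with every numeral. -/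
theorem le_total_num (a : M) (n : ℕ) : S.le a (S.num n) ∨ S.le (S.num n) a := by
  induction n with
  | zero => exact .inr ((hS.le_iff _ _).2 ⟨a, hS.add_zero a⟩)
  | succ n ih =>
    rcases ih with h | h
    · obtain ⟨k, hk, rfl⟩ := hS.le_num_iff.1 h
      exact .inl (hS.num_le_num.2 (Nat.le_succ_of_le hk))
    · obtain ⟨c, hc⟩ := (hS.le_iff _ _).1 h
      by_cases hc0 : c = S.zero
      · left
        rw [hc0, show S.zero = S.num 0 from rfl, hS.add_num, Nat.zero_add] at hc
        rw [← hc]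
        exact hS.num_le_num.2 (Nat.le_succ n)
      · obtain ⟨b, rfl⟩ := (hS.ne_zero_iff c).1 hc0
        right
        rw [hS.succ_add_num] at hc
        exact (hS.le_iff _ _).2 ⟨b, hc⟩

end IsQModel

/-! ### Bounded formulas and `Σ`-completeness -/

/-- Bounded formulas, i.e. `Σ`-formulas without unbounded quantifiers. -/
inductive IsBounded : PreFormula → Prop
  | literal {φ : PreFormula} (h : IsLiteral φ) : IsBounded φ
  | and {φ ψ : PreFormula} (hφ : IsBounded φ) (hψ : IsBounded ψ) : IsBounded (and φ ψ)
  | or {φ ψ : PreFormula} (hφ : IsBounded φ) (hψ : IsBounded ψ) : IsBounded (or φ ψ)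
  | ball {φ : PreFormula} (i : ℕ) (t : PreTerm) (ht : 2 * i ∉ t.FV) (hφ : IsBounded φ) :
      IsBounded (all i (imp (le (.var (2 * i)) t) φ))
  | bex {φ : PreFormula} (i : ℕ) (t : PreTerm) (ht : 2 * i ∉ t.FV) (hφ : IsBounded φ) :
      IsBounded (ex i (PreFormula.and (le (.var (2 * i)) t) φ))

theorem IsBounded.isSigma {φ : PreFormula} (h : IsBounded φ) : IsSigma φ := by
  induction h with
  | literal h => exact .literal h
  | and _ _ h1 h2 => exact .and h1 h2
  | or _ _ h1 h2 => exact .or h1 h2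
  | ball i t ht _ ih => exact .ball i t ht ih
  | bex i t ht _ ih => exact .bex i t ht ih

theorem IsBounded.neg {φ : PreFormula} (h : IsBounded φ) : IsBounded φ.neg := by
  induction h with
  | @literal φ h => cases φ <;> first | exact h.elim | exact .literal trivial
  | and _ _ h1 h2 => exact .or h1 h2
  | or _ _ h1 h2 => exact .and h1 h2
  | ball i t ht _ ih => exact .bex i t ht ih
  | bex i t ht _ ih => exact .ball i t ht ih

/-- True `Σ`-formulas hold in all models of Robinson arithmetic. -/
theorem IsQModel.sat_of_isSigma {M : Type} {S : ArithStr M} (hS : IsQModel S) {φ : PreFormula}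
    (hφ : IsSigma φ) (η : ℕ → ℕ) (h : std.Sat η φ) : S.Sat (S.num ∘ η) φ := by
  induction hφ generalizing η with
  | @literal φ hl =>
    cases φ <;> first | exact hl.elim | skip
    all_goals
      simpa [Sat, hS.val_num, hS.eq_iff, hS.num_inj, hS.num_le_num, ArithStr.std_eq,
        ArithStr.std_le, val_std] using h
  | and _ _ h1 h2 => exact ⟨h1 η h.1, h2 η h.2⟩
  | or _ _ h1 h2 => exact h.imp (h1 η) (h2 η)
  | ball i t ht _ ih =>
    intro a
    rw [sat_imp]
    intro ha
    simp only [Sat, val_update_of_notMem _ ht, hS.val_num] at ha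
    obtain ⟨k, hk, hk'⟩ := hS.le_num_iff.1 ha
    simp only [val, Function.update_self] at hk'
    subst hk'
    rw [← Function.comp_update]
    apply ih
    have := h k
    rw [sat_imp] at this
    apply this
    simpa [Sat, val_update_of_notMem _ ht, val, val_std, ArithStr.std_le] using hk
  | bex i t ht _ ih =>
    obtain ⟨k, hk, hk'⟩ := h
    refine ⟨S.num k, ?_, ?_⟩
    · simp only [Sat, val_update_of_notMem _ ht, hS.val_num]
      simp only [Sat, val_update_of_notMem _ ht, val_std, ArithStr.std_le] at hk
      simp only [val, PreTerm.val, Function.update_self] at hk ⊢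
      exact hS.num_le_num.2 hk
    · rw [← Function.comp_update]
      exact ih _ hk'
  | ex i _ ih =>
    obtain ⟨k, hk⟩ := h
    refine ⟨S.num k, ?_⟩
    rw [← Function.comp_update]
    exact ih _ hk

/-- Bounded formulas are absolute between the standard model and models of Robinson arithmetic. -/
theorem IsQModel.sat_iff_of_isBounded {M : Type} {S : ArithStr M} (hS : IsQModel S)
    {φ : PreFormula} (hφ : IsBounded φ) (η : ℕ → ℕ) : S.Sat (S.num ∘ η) φ ↔ std.Sat η φ := by
  refine ⟨fun h => ?_, hS.sat_of_isSigma hφ.isSigma η⟩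
  by_contra hn
  rw [← sat_neg] at hn
  exact (S.sat_neg _ _).1 (hS.sat_of_isSigma hφ.neg.isSigma η hn) h

/-- Each `Σ`-formula is equivalent in the standard model to one of the form `∃ w φ` with `φ` bounded
and monotone in `w`: unbounded existential quantifiers are bounded by `w`. -/
theorem exists_bounded_of_isSigma {φ : PreFormula} (hφ : IsSigma φ) :
    ∃ m₀, ∀ m ≥ m₀, ∃ φ', IsBounded φ' ∧ φ'.FV ⊆ insert (2 * m) φ.FV ∧
      (∀ (η : ℕ → ℕ) (v w : ℕ), v ≤ w → std.Sat (Function.update η (2 * m) v) φ' →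
        std.Sat (Function.update η (2 * m) w) φ') ∧
      ∀ η : ℕ → ℕ, std.Sat η φ ↔ ∃ w, std.Sat (Function.update η (2 * m) w) φ' := by
  have fresh : ∀ A : Finset ℕ, ∃ m₀, ∀ m ≥ m₀, 2 * m ∉ A := by
    intro A
    refine ⟨A.sup id + 1, fun m hm hmem => ?_⟩
    have : 2 * m ≤ A.sup id := Finset.le_sup (f := id) hmem
    omega
  have upd : ∀ {i m : ℕ} (_ : m ≠ i) (η : ℕ → ℕ) (a w : ℕ),
      Function.update (Function.update η (2 * m) w) (2 * i) a =
        Function.update (Function.update η (2 * i) a) (2 * m) w := by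
    intro i m h η a w
    rw [Function.update_comm (by omega)]
  induction hφ with
  | @literal φ hl =>
    obtain ⟨m₀, hm₀⟩ := fresh φ.FV
    refine ⟨m₀, fun m hm => ⟨φ, .literal hl, Finset.subset_insert _ _, ?_⟩⟩
    have key : ∀ (η : ℕ → ℕ) w, std.Sat (Function.update η (2 * m) w) φ ↔ std.Sat η φ := by
      intro η w
      refine std.sat_congr φ fun i hi => Function.update_of_ne ?_ _ _
      rintro rfl
      exact hm₀ m hm hi
    simp [key]
  | @and φ ψ _ _ h1 h2 =>
    obtain ⟨m₁, h1⟩ := h1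
    obtain ⟨m₂, h2⟩ := h2
    refine ⟨max m₁ m₂, fun m hm => ?_⟩
    obtain ⟨φ', hb1, hf1, hmono1, heq1⟩ := h1 m (le_of_max_le_left hm)
    obtain ⟨ψ', hb2, hf2, hmono2, heq2⟩ := h2 m (le_of_max_le_right hm)
    refine ⟨.and φ' ψ', .and hb1 hb2, by simp only [PreFormula.FV]; grind, ?_, ?_⟩
    · exact fun η v w h h' => ⟨hmono1 η v w h h'.1, hmono2 η v w h h'.2⟩
    · intro η
      simp only [Sat, heq1 η, heq2 η]
      constructor
      · rintro ⟨⟨v, hv⟩, w, hw⟩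
        exact ⟨max v w, hmono1 η v _ (le_max_left _ _) hv, hmono2 η w _ (le_max_right _ _) hw⟩
      · rintro ⟨w, h, h'⟩
        exact ⟨⟨w, h⟩, w, h'⟩
  | @or φ ψ _ _ h1 h2 =>
    obtain ⟨m₁, h1⟩ := h1
    obtain ⟨m₂, h2⟩ := h2
    refine ⟨max m₁ m₂, fun m hm => ?_⟩
    obtain ⟨φ', hb1, hf1, hmono1, heq1⟩ := h1 m (le_of_max_le_left hm)
    obtain ⟨ψ', hb2, hf2, hmono2, heq2⟩ := h2 m (le_of_max_le_right hm)
    refine ⟨.or φ' ψ', .or hb1 hb2, by simp only [PreFormula.FV]; grind, ?_, ?_⟩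
    · exact fun η v w h => Or.imp (hmono1 η v w h) (hmono2 η v w h)
    · intro η
      simp only [Sat, heq1 η, heq2 η, exists_or]
  | @ball φ i t ht _ ih =>
    obtain ⟨m₁, ih⟩ := ih
    obtain ⟨m₂, hm₂⟩ := fresh t.FV
    refine ⟨max (max m₁ m₂) (i + 1), fun m hm => ?_⟩
    obtain ⟨φ', hb, hf, hmono, heq⟩ := ih m (by omega)
    have hmi : m ≠ i := by omega
    have hmt : 2 * m ∉ t.FV := hm₂ m (by omega)
    have hsat : ∀ (η : ℕ → ℕ) χ, std.Sat η (all i (imp (le (.var (2 * i)) t) χ)) ↔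
        ∀ a ≤ t.val η, std.Sat (Function.update η (2 * i) a) χ := by
      intro η χ
      simp [Sat, sat_imp, val_update_of_notMem _ ht, val, val_std, ArithStr.std_le]
    have hvt : ∀ (η : ℕ → ℕ) w, t.val (Function.update η (2 * m) w) = t.val η := by
      intro η w
      rw [← val_std, val_update_of_notMem _ hmt, val_std]
    refine ⟨_, .ball i t ht hb, by simp only [PreFormula.FV, imp, neg]; grind, ?_, ?_⟩
    · intro η v w h
      simp only [hsat, hvt, upd hmi]
      exact fun h' a ha => hmono _ v w h (h' a ha)
    · intro η
      simp only [hsat, hvt, heq, upd hmi]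
      constructor
      · intro h
        choose! f hf using h
        refine ⟨(Finset.range (t.val η + 1)).sup f, fun a ha => hmono _ _ _ ?_ (hf a ha)⟩
        exact Finset.le_sup (f := f) (by simpa [Nat.lt_succ_iff] using ha)
      · rintro ⟨w, h⟩ a ha
        exact ⟨w, h a ha⟩
  | @bex φ i t ht _ ih =>
    obtain ⟨m₁, ih⟩ := ih
    obtain ⟨m₂, hm₂⟩ := fresh t.FV
    refine ⟨max (max m₁ m₂) (i + 1), fun m hm => ?_⟩
    obtain ⟨φ', hb, hf, hmono, heq⟩ := ih m (by omega)
    have hmi : m ≠ i := by omega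
    have hmt : 2 * m ∉ t.FV := hm₂ m (by omega)
    have hsat : ∀ (η : ℕ → ℕ) χ, std.Sat η (ex i (PreFormula.and (le (.var (2 * i)) t) χ)) ↔
        ∃ a ≤ t.val η, std.Sat (Function.update η (2 * i) a) χ := by
      intro η χ
      simp [Sat, val_update_of_notMem _ ht, val, val_std, ArithStr.std_le]
    have hvt : ∀ (η : ℕ → ℕ) w, t.val (Function.update η (2 * m) w) = t.val η := by
      intro η w
      rw [← val_std, val_update_of_notMem _ hmt, val_std]
    refine ⟨_, .bex i t ht hb, by simp only [PreFormula.FV]; grind, ?_, ?_⟩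
    · intro η v w h
      simp only [hsat, hvt, upd hmi]
      exact fun ⟨a, ha, h'⟩ => ⟨a, ha, hmono _ v w h h'⟩
    · intro η
      simp only [hsat, hvt, heq, upd hmi]
      grind
  | @ex φ i _ ih =>
    obtain ⟨m₁, ih⟩ := ih
    refine ⟨max m₁ (i + 1), fun m hm => ?_⟩
    obtain ⟨φ', hb, hf, hmono, heq⟩ := ih m (by omega)
    have hmi : m ≠ i := by omega
    have ht : 2 * i ∉ (PreTerm.var (2 * m)).FV := by simp [PreTerm.FV, hmi.symm]
    have hsat : ∀ (η : ℕ → ℕ) w, std.Sat (Function.update η (2 * m) w)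
        (ex i (PreFormula.and (le (.var (2 * i)) (.var (2 * m))) φ')) ↔
        ∃ a ≤ w, std.Sat (Function.update (Function.update η (2 * i) a) (2 * m) w) φ' := by
      intro η w
      simp [Sat, val, ArithStr.std_le, upd hmi]
    refine ⟨_, .bex i (.var (2 * m)) ht hb, by
      simp only [PreFormula.FV, PreTerm.FV]; grind, ?_, ?_⟩
    · intro η v w h
      simp only [hsat]
      exact fun ⟨a, ha, h'⟩ => ⟨a, ha.trans h, hmono _ v w h h'⟩
    · intro η
      simp only [hsat]
      constructor
      · rintro ⟨a, ha⟩
        obtain ⟨w, hw⟩ := (heq _).1 ha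
        exact ⟨max a w, a, le_max_left _ _, hmono _ _ _ (le_max_right _ _) hw⟩
      · rintro ⟨w, a, _, h⟩
        exact ⟨a, (heq _).2 ⟨w, h⟩⟩

/-! ### Rosser's separation argument -/

/-- A set of natural numbers is `SigmaSet` if it is defined by a `Σ`-formula in the variable `v₀`.
Other variables may occur freely in the formula, as long as its truth in the standard model does
not depend on them. -/
def SigmaSet (A : ℕ → Prop) : Prop :=
  ∃ φ, IsSigma φ ∧ ∀ η : ℕ → ℕ, std.Sat η φ ↔ A (η 0)

theorem PreTerm.notMem_FV_subst {s t : PreTerm} {i j : ℕ} (hs : j ∉ s.FV)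
    (ht : j ∉ t.FV) : j ∉ (s.subst i t).FV := by
  intro h
  rcases Finset.mem_union.1 (s.FV_subst_subset i t h) with h | h
  · exact hs (Finset.mem_of_mem_erase h)
  · exact ht h

theorem PreFormula.IsSigma.subst {φ : PreFormula} (hφ : IsSigma φ) (i : ℕ)
    (t : PreTerm) (ht : ∀ j ∈ φ.BV, 2 * j ∉ t.FV) : IsSigma (φ.subst i t) := by
  induction hφ with
  | @literal φ h => cases φ <;> first | exact h.elim | exact .literal trivial
  | and _ _ h1 h2 =>
    exact .and (h1 fun j hj => ht j (Finset.mem_union_left _ hj))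
      (h2 fun j hj => ht j (Finset.mem_union_right _ hj))
  | or _ _ h1 h2 =>
    exact .or (h1 fun j hj => ht j (Finset.mem_union_left _ hj))
      (h2 fun j hj => ht j (Finset.mem_union_right _ hj))
  | @ball φ j u hu hφ ih =>
    by_cases hij : i = 2 * j
    · simpa [PreFormula.subst, hij] using IsSigma.ball j u hu hφ
    · have := IsSigma.ball j (u.subst i t) (notMem_FV_subst hu (ht j (by simp [BV])))
        (ih fun k hk => ht k (by simp [BV, imp, neg, hk]))
      simpa [PreFormula.subst, PreTerm.subst, imp, neg, hij] using this
  | @bex φ j u hu hφ ih =>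
    by_cases hij : i = 2 * j
    · simpa [PreFormula.subst, hij] using IsSigma.bex j u hu hφ
    · have := IsSigma.bex j (u.subst i t) (notMem_FV_subst hu (ht j (by simp [BV])))
        (ih fun k hk => ht k (by simp [BV, hk]))
      simpa [PreFormula.subst, PreTerm.subst, hij] using this
  | @ex φ j hφ ih =>
    by_cases hij : i = 2 * j
    · simpa [PreFormula.subst, hij] using IsSigma.ex j hφ
    · have := IsSigma.ex j (ih fun k hk => ht k (by simp [BV, hk]))
      simpa [PreFormula.subst, hij] using this

/-- The numeral for a natural number. -/
def numeral : ℕ → PreTerm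
  | 0 => .zero
  | n + 1 => .succ (numeral n)

@[simp] theorem FV_numeral (n : ℕ) : (numeral n).FV = ∅ := by
  induction n <;> simp_all [numeral, PreTerm.FV]

theorem val_numeral {M : Type} (S : ArithStr M) (η : ℕ → M) (n : ℕ) :
    S.val η (numeral n) = S.num n := by
  induction n <;> simp_all [numeral, val, num]

/-- Rosser's separation argument: disjoint `Σ`-definable sets are separated, provably in Robinson
arithmetic, by a `Σ`-formula. If `∃ w β(x, w)` and `∃ w α(x, w)` define the sets with `α`, `β`
bounded, the separating formula is `∃ w (β(x, w) ∧ ∀ v ≤ w ¬ α(x, v))`. -/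
theorem exists_separating_formula {A B : ℕ → Prop} (hA : SigmaSet A) (hB : SigmaSet B)
    (hAB : ∀ n, A n → B n → False) :
    ∃ σ, IsSigma σ ∧ ∀ (M : Type) (S : ArithStr M), IsQModel S → ∀ η : ℕ → ℕ,
      (B (η 0) → S.Sat (S.num ∘ η) σ) ∧ (A (η 0) → ¬ S.Sat (S.num ∘ η) σ) := by
  obtain ⟨α, hα, hαA⟩ := hA
  obtain ⟨β, hβ, hβB⟩ := hB
  obtain ⟨m₁, h1⟩ := exists_bounded_of_isSigma hα
  obtain ⟨m₂, h2⟩ := exists_bounded_of_isSigma hβ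
  obtain ⟨m, hm, hm1⟩ : ∃ m, m ≥ max m₁ m₂ ∧ m ≥ α.FV.sup id + 1 :=
    ⟨max (max m₁ m₂) (α.FV.sup id + 1), by omega, by omega⟩
  -- `β` is used with the bound `v₂ₘ`, and `α` with the bound `v₂ₖ` for `k = m + 1`.
  obtain ⟨k, hk⟩ : ∃ k, k = m + 1 := ⟨_, rfl⟩
  obtain ⟨α', hα', hαf, -, hαeq⟩ := h1 k (by omega)
  obtain ⟨β', hβ', -, -, hβeq⟩ := h2 m (by omega)
  have hmk : 2 * k ∉ (PreTerm.var (2 * m)).FV := by simp [PreTerm.FV]; omega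
  have hγ : IsBounded (all k (imp (le (.var (2 * k)) (.var (2 * m))) α'.neg)) :=
    .ball k _ hmk hα'.neg
  refine ⟨ex m (PreFormula.and β' (all k (imp (le (.var (2 * k)) (.var (2 * m))) α'.neg))),
    .ex m (.and hβ'.isSigma hγ.isSigma), fun M S hS η => ⟨fun hB => ?_, fun hA => ?_⟩⟩
  · apply hS.sat_of_isSigma (.ex m (.and hβ'.isSigma hγ.isSigma))
    obtain ⟨w, hw⟩ := (hβeq η).1 ((hβB η).2 hB)
    refine ⟨w, hw, fun v => ?_⟩
    rw [sat_imp, sat_neg]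
    intro _ h
    have := (hαA _).1 ((hαeq _).2 ⟨v, h⟩)
    rw [Function.update_of_ne (by omega)] at this
    exact hAB _ this hB
  · rintro ⟨a, ha, hall⟩
    obtain ⟨v, hv⟩ := (hαeq η).1 ((hαA η).2 hA)
    -- If `a ≤ v`, then `a` is standard, and `a` would witness that `η 0` is in `B`. If `v ≤ a`, then `v`
    -- is among the witnesses for `A` that are excluded by the formula.
    rcases hS.le_total_num a v with h | h
    · obtain ⟨w, hw, rfl⟩ := hS.le_num_iff.1 h
      rw [← Function.comp_update] at ha
      have := (hβB _).1 ((hβeq η).2 ⟨w, (hS.sat_iff_of_isBounded hβ' _).1 ha⟩)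
      exact hAB _ hA this
    · have hv' := hall (S.num v)
      rw [sat_imp, sat_neg] at hv'
      apply hv'
      · simpa [Sat, val, Function.update_of_ne (show 2 * m ≠ 2 * k by omega)] using h
      · rw [← hS.sat_iff_of_isBounded hα', Function.comp_update] at hv
        -- The possibly nonstandard value `a` does not matter, as `v₂ₘ` is not free in `α'`.
        refine (S.sat_congr α' fun i hi => ?_).1 hv
        rw [Function.update_comm (by omega)]
        refine (Function.update_of_ne ?_ _ _).symm
        rintro rfl
        rcases Finset.mem_insert.1 (hαf hi) with h' | h'
        · omega
        · have : 2 * m ≤ α.FV.sup id := Finset.le_sup (f := id) h'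
          omega

/-- The separating formula can be chosen without free variables other than `v₀`. -/
theorem exists_separating_formula_FV {A B : ℕ → Prop} (hA : SigmaSet A) (hB : SigmaSet B)
    (hAB : ∀ n, A n → B n → False) :
    ∃ σ, IsSigma σ ∧ σ.FV ⊆ {0} ∧ ∀ (M : Type) (S : ArithStr M), IsQModel S → ∀ η : ℕ → ℕ,
      (B (η 0) → S.Sat (S.num ∘ η) σ) ∧ (A (η 0) → ¬ S.Sat (S.num ∘ η) σ) := by
  obtain ⟨σ, hσ, h⟩ := exists_separating_formula hA hB hAB
  -- Spurious free variables are replaced by `0`, one at a time.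
  induction hn : (σ.FV.erase 0).card using Nat.strong_induction_on generalizing σ with
  | _ n ih =>
    by_cases he : σ.FV.erase 0 = ∅
    · refine ⟨σ, hσ, fun i hi => ?_, h⟩
      by_contra h0
      have : i ∈ σ.FV.erase 0 := Finset.mem_erase.2 ⟨by simpa using h0, hi⟩
      simp [he] at this
    · obtain ⟨j, hj⟩ := Finset.nonempty_iff_ne_empty.2 he
      have hz : (PreTerm.zero).FV = ∅ := rfl
      have hsub := σ.FV_subst_subset j .zero
      rw [hz, Finset.union_empty] at hsub
      refine ih _ ?_ (σ.subst j .zero) (hσ.subst j _ (by simp [hz])) ?_ rfl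
      · rw [← hn]
        apply Finset.card_lt_card
        refine ⟨fun i hi => ?_, fun h' => ?_⟩
        · have := hsub (Finset.mem_of_mem_erase hi)
          grind
        · have := hsub (Finset.mem_of_mem_erase (h' hj))
          simp at this
      · intro M S hS η
        rw [ArithStr.sat_subst _ _ _ _ _ (by simp [hz]),
          show S.val (S.num ∘ η) .zero = S.num 0 from rfl, ← Function.comp_update]
        have := h M S hS (Function.update η j 0)
        rwa [Function.update_of_ne (Finset.ne_of_mem_erase hj).symm] at this

theorem PreTerm.val_update {t : PreTerm} {i : ℕ} (h : i ∉ t.FV) (η : ℕ → ℕ)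
    (a : ℕ) : t.val (Function.update η i a) = t.val η := by
  rw [← val_std, val_update_of_notMem _ h, val_std]

/-! ### Relations on assignments defined by `Σ`-formulas -/

/-- The relation `P` on assignments is defined by a `Σ`-formula in the standard model. -/
def SigmaEnv (P : (ℕ → ℕ) → Prop) : Prop :=
  ∃ φ, IsSigma φ ∧ ∀ η : ℕ → ℕ, std.Sat η φ ↔ P η

namespace SigmaEnv

variable {P Q : (ℕ → ℕ) → Prop}

theorem congr (h : SigmaEnv P) (hPQ : ∀ η, P η ↔ Q η) : SigmaEnv Q := by
  obtain rfl : P = Q := funext fun η => propext (hPQ η)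
  exact h

theorem eq (s t : PreTerm) : SigmaEnv fun η => s.val η = t.val η :=
  ⟨.eq s t, .literal trivial, fun η => by simp [Sat, val_std, ArithStr.std_eq]⟩

theorem and (hP : SigmaEnv P) (hQ : SigmaEnv Q) : SigmaEnv fun η => P η ∧ Q η := by
  obtain ⟨φ, hφ, h⟩ := hP
  obtain ⟨ψ, hψ, h'⟩ := hQ
  exact ⟨.and φ ψ, .and hφ hψ, fun η => by simp [Sat, h, h']⟩

theorem or (hP : SigmaEnv P) (hQ : SigmaEnv Q) : SigmaEnv fun η => P η ∨ Q η := by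
  obtain ⟨φ, hφ, h⟩ := hP
  obtain ⟨ψ, hψ, h'⟩ := hQ
  exact ⟨.or φ ψ, .or hφ hψ, fun η => by simp [Sat, h, h']⟩

theorem ex (i : ℕ) (hP : SigmaEnv P) :
    SigmaEnv fun η => ∃ a, P (Function.update η (2 * i) a) := by
  obtain ⟨φ, hφ, h⟩ := hP
  exact ⟨.ex i φ, .ex i hφ, fun η => by simp [Sat, h]⟩

theorem ball (i : ℕ) (t : PreTerm) (ht : 2 * i ∉ t.FV) (hP : SigmaEnv P) :
    SigmaEnv fun η => ∀ a ≤ t.val η, P (Function.update η (2 * i) a) := by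
  obtain ⟨φ, hφ, h⟩ := hP
  exact ⟨_, .ball i t ht hφ, fun η => by
    simp [Sat, sat_imp, val_update_of_notMem _ ht, val, val_std, ArithStr.std_le, h]⟩

theorem exists_fresh (A : Finset ℕ) : ∃ m ≥ 1, 2 * m ∉ A := by
  refine ⟨A.sup id + 1, by omega, fun hmem => ?_⟩
  have : 2 * (A.sup id + 1) ≤ A.sup id := Finset.le_sup (f := id) hmem
  omega

theorem mem {A : ℕ → Prop} (hA : SigmaSet A) (i : ℕ) : SigmaEnv fun η => A (η (2 * i)) := by
  rcases Nat.eq_zero_or_pos i with rfl | hi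
  · exact hA
  · refine (ex 0 ((eq (.var 0) (.var (2 * i))).and hA)).congr fun η => ?_
    simp [PreTerm.val, Function.update_of_ne (show 2 * i ≠ 0 by omega)]

/-- The defining equation of the pairing function is a polynomial one once it is doubled. -/
theorem eq_pair (r s t : PreTerm) :
    SigmaEnv fun η => r.val η = cantorPair (s.val η) (t.val η) := by
  refine (eq (.add r r) (.add (.add t t) (.mul (.add s t) (.succ (.add s t))))).congr fun η => ?_
  have := two_mul_cantorPair (s.val η) (t.val η)
  simp only [PreTerm.val]
  omega

/-- Composition with the pairing function, which is not given by a term: the pair becomes the value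
of a fresh, existentially quantified variable. -/
theorem mem_pair {A : ℕ → Prop} (hA : SigmaSet A) (s t : PreTerm) :
    SigmaEnv fun η => A (cantorPair (s.val η) (t.val η)) := by
  obtain ⟨m, -, hm⟩ := exists_fresh (s.FV ∪ t.FV)
  rw [Finset.mem_union, not_or] at hm
  refine (ex m ((eq_pair (.var (2 * m)) s t).and (mem hA m))).congr fun η => ?_
  simp [PreTerm.val, PreTerm.val_update hm.1, PreTerm.val_update hm.2]

theorem sigmaSet (hP : SigmaEnv P) {A : ℕ → Prop} (h : ∀ η, P η ↔ A (η 0)) : SigmaSet A :=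
  hP.congr h

end SigmaEnv

/-- `SigmaDefinable` sets can be defined using the variable `v₀`. -/
theorem SigmaDefinable.sigmaSet {A : Set ℕ} (h : SigmaDefinable A) : SigmaSet (· ∈ A) := by
  obtain ⟨φ, k, -, hφ, -, hA⟩ := h
  -- The odd-indexed variable `vₖ` cannot be quantified, so it is first renamed to a fresh `v₂ₘ`.
  obtain ⟨m, hm1, hm⟩ := SigmaEnv.exists_fresh (φ.BV.image (2 * ·))
  have hfree : ∀ j ∈ φ.BV, 2 * j ∉ (PreTerm.var (2 * m)).FV := by
    intro j hj h
    simp only [PreTerm.FV, Finset.mem_singleton] at h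
    exact hm (h ▸ Finset.mem_image_of_mem _ hj)
  have hsub : SigmaEnv fun η => η (2 * m) ∈ A := by
    refine ⟨φ.subst k (.var (2 * m)), hφ.subst k _ hfree, fun η => ?_⟩
    rw [ArithStr.sat_subst _ _ _ _ _ hfree, ArithStr.sat_std,
      ← hA (η (2 * m)) _ (by simp [val])]
  refine (SigmaEnv.ex m ((SigmaEnv.eq (.var (2 * m)) (.var 0)).and hsub)).sigmaSet fun η => ?_
  simp [PreTerm.val, Function.update_of_ne (show 0 ≠ 2 * m by omega)]

/-! ### `Σ`-predicates and `Σ`-functions on coded types -/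

/-- A type whose elements are coded injectively by the elements of a `Σ`-definable set of natural
numbers. -/
class SigmaType (α : Type) where
  code : α → ℕ
  code_injective : Function.Injective code
  sigmaSet_range : SigmaSet fun n => ∃ a : α, code a = n

open SigmaType (code code_injective sigmaSet_range)

variable {α β γ : Type} [SigmaType α] [SigmaType β] [SigmaType γ]

/-- `Codes P n` means that `n` is the code of an element satisfying `P`. -/
def Codes (P : α → Prop) (n : ℕ) : Prop := ∃ a, code a = n ∧ P a

@[simp] theorem codes_code (P : α → Prop) (a : α) : Codes P (code a) ↔ P a :=
  ⟨fun ⟨_, h, hb⟩ => code_injective h ▸ hb, fun h => ⟨a, rfl, h⟩⟩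

/-- A predicate is `Σ` if the codes of the elements satisfying it form a `Σ`-definable set. -/
@[fun_prop] def SigmaPred (P : α → Prop) : Prop := SigmaSet (Codes P)

instance : SigmaType ℕ where
  code := id
  code_injective := Function.injective_id
  sigmaSet_range := ⟨.eq .zero .zero, .literal trivial, fun η => by
    simp [Sat, ArithStr.std_eq]⟩

instance : SigmaType (α × β) where
  code p := cantorPair (code p.1) (code p.2)
  code_injective := by
    rintro ⟨a, b⟩ ⟨c, d⟩ h
    obtain ⟨h1, h2⟩ := cantorPair_inj.1 h
    exact Prod.ext (code_injective h1) (code_injective h2)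
  sigmaSet_range := by
    refine ((SigmaEnv.eq_pair (.var 0) (.var 2) (.var 4)).and
      ((SigmaEnv.mem (sigmaSet_range (α := α)) 1).and
      (SigmaEnv.mem (sigmaSet_range (α := β)) 2)) |>.ex 2 |>.ex 1).sigmaSet fun η => ?_
    simp only [PreTerm.val]
    constructor
    · rintro ⟨_, _, h, ⟨a, ha⟩, b, hb⟩
      refine ⟨(a, b), ?_⟩
      simp_all
    · rintro ⟨⟨a, b⟩, h⟩
      exact ⟨code a, code b, by simpa using h.symm, ⟨a, by simp⟩, b, by simp⟩

theorem code_nat (n : ℕ) : code n = n := rfl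

theorem code_pair (a : α) (b : β) : code (a, b) = cantorPair (code a) (code b) := rfl

/-- A function is `Σ` if its graph is. -/
@[fun_prop] def SigmaFn (f : α → β) : Prop := SigmaPred fun p : α × β => p.2 = f p.1

theorem codes_graph {f : α → β} {a : α} {n : ℕ} :
    Codes (fun p : α × β => p.2 = f p.1) (cantorPair (code a) n) ↔ n = code (f a) := by
  constructor
  · rintro ⟨⟨a', b⟩, h, hb⟩
    obtain ⟨h1, rfl⟩ := cantorPair_inj.1 h
    obtain rfl := code_injective h1
    exact congrArg code hb
  · rintro rfl
    exact ⟨(a, f a), rfl, rfl⟩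

theorem codes_graph_iff {f : α → β} {m n : ℕ} :
    Codes (fun p : α × β => p.2 = f p.1) (cantorPair m n) ↔ ∃ a, code a = m ∧ n = code (f a) := by
  constructor
  · rintro ⟨⟨a', b⟩, h, hb⟩
    obtain ⟨h1, rfl⟩ := cantorPair_inj.1 h
    exact ⟨a', h1, congrArg code hb⟩
  · rintro ⟨a, rfl, rfl⟩
    exact codes_graph.2 rfl

theorem SigmaPred.congr {P Q : α → Prop} (hP : SigmaPred P) (h : ∀ a, Q a ↔ P a) :
    SigmaPred Q := by
  obtain rfl : Q = P := funext fun a => propext (h a)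
  exact hP

@[fun_prop] theorem SigmaPred.and {P Q : α → Prop} (hP : SigmaPred P) (hQ : SigmaPred Q) :
    SigmaPred fun a => P a ∧ Q a := by
  refine ((SigmaEnv.mem hP 0).and (SigmaEnv.mem hQ 0)).sigmaSet fun η => ?_
  constructor
  · rintro ⟨⟨a, ha, h⟩, h'⟩
    rw [← ha] at h'
    exact ⟨a, ha, h, (codes_code Q a).1 h'⟩
  · rintro ⟨a, ha, h, h'⟩
    exact ⟨⟨a, ha, h⟩, a, ha, h'⟩

@[fun_prop] theorem SigmaPred.or {P Q : α → Prop} (hP : SigmaPred P) (hQ : SigmaPred Q) :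
    SigmaPred fun a => P a ∨ Q a := by
  refine ((SigmaEnv.mem hP 0).or (SigmaEnv.mem hQ 0)).sigmaSet fun η => ?_
  simp only [Codes]
  grind

@[fun_prop] theorem SigmaPred.ex {P : α → β → Prop} (hP : SigmaPred fun p : α × β => P p.1 p.2) :
    SigmaPred fun a => ∃ b, P a b := by
  refine ((SigmaEnv.mem_pair hP (.var 0) (.var 2)).ex 1).sigmaSet fun η => ?_
  simp only [PreTerm.val]
  constructor
  · rintro ⟨n, ⟨a, b⟩, h, hab⟩
    exact ⟨a, (cantorPair_inj.1 h).1, b, hab⟩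
  · rintro ⟨a, ha, b, hab⟩
    refine ⟨code b, (a, b), ?_, hab⟩
    simp [code_pair, ha]

theorem SigmaPred.comp {P : β → Prop} {f : α → β} (hP : SigmaPred P) (hf : SigmaFn f) :
    SigmaPred fun a => P (f a) := by
  refine ((SigmaEnv.mem_pair hf (.var 0) (.var 2)).and (SigmaEnv.mem hP 1) |>.ex 1).sigmaSet
    fun η => ?_
  simp only [PreTerm.val, codes_graph_iff]
  constructor
  · rintro ⟨n, ⟨a, ha, h⟩, h'⟩
    simp only [mul_one, Function.update_self] at h h'
    subst h
    exact ⟨a, ha, (codes_code P _).1 h'⟩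
  · rintro ⟨a, ha, h⟩
    exact ⟨code (f a), ⟨a, by simpa using ha, by simp⟩, by simpa using h⟩

@[fun_prop] theorem SigmaFn.id : SigmaFn fun a : α => a := by
  refine ((SigmaEnv.eq_pair (.var 0) (.var 2) (.var 2)).and
    (SigmaEnv.mem (sigmaSet_range (α := α)) 1) |>.ex 1).sigmaSet fun η => ?_
  simp only [PreTerm.val]
  constructor
  · rintro ⟨_, h, a, rfl⟩
    exact ⟨(a, a), by simpa [code_pair] using h.symm, rfl⟩
  · rintro ⟨⟨a, b⟩, h, hb⟩
    obtain rfl : b = a := hb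
    exact ⟨code b, by simpa [code_pair] using h.symm, b, by simp⟩

@[fun_prop] theorem SigmaFn.const (b : β) : SigmaFn fun _ : α => b := by
  have hval : ∀ η, (numeral (code b)).val η = code b := by
    intro η
    rw [← val_std, val_numeral]
    induction code b with
    | zero => rfl
    | succ n ih => rw [num, ih]; rfl
  refine ((SigmaEnv.eq_pair (.var 0) (.var 2) (numeral (code b))).and
    (SigmaEnv.mem (sigmaSet_range (α := α)) 1) |>.ex 1).sigmaSet fun η => ?_
  simp only [PreTerm.val, hval]
  constructor
  · rintro ⟨_, h, a, rfl⟩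
    exact ⟨(a, b), by simpa [code_pair] using h.symm, rfl⟩
  · rintro ⟨⟨a, b'⟩, h, hb⟩
    obtain rfl : b' = b := hb
    exact ⟨code a, by simpa [code_pair] using h.symm, a, by simp⟩

@[fun_prop] theorem SigmaFn.comp {f : β → γ} {g : α → β} (hf : SigmaFn f) (hg : SigmaFn g) :
    SigmaFn fun a => f (g a) := by
  refine ((SigmaEnv.eq_pair (.var 0) (.var 2) (.var 6)).and
    ((SigmaEnv.mem_pair hg (.var 2) (.var 4)).and (SigmaEnv.mem_pair hf (.var 4) (.var 6)))
    |>.ex 3 |>.ex 2 |>.ex 1).sigmaSet fun η => ?_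
  simp only [PreTerm.val, codes_graph_iff]
  constructor
  · intro h
    obtain ⟨b, a, h1, h2⟩ : ∃ b a, η 0 = cantorPair (code a) (code (f b)) ∧
        code b = code (g a) := by
      simpa using h
    obtain rfl := code_injective h2
    exact ⟨(a, f (g a)), h1.symm, rfl⟩
  · rintro ⟨⟨a, c⟩, h, hc⟩
    obtain rfl : c = f (g a) := hc
    suffices ∃ b a, η 0 = cantorPair (code a) (code (f b)) ∧ code b = code (g a) by
      simpa using this
    exact ⟨g a, a, h.symm, rfl⟩

theorem SigmaFn.fst' : SigmaFn fun p : α × β => p.1 := by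
  refine ((SigmaEnv.eq_pair (.var 0) (.var 6) (.var 2)).and
    ((SigmaEnv.eq_pair (.var 6) (.var 2) (.var 4)).and
    ((SigmaEnv.mem (sigmaSet_range (α := α)) 1).and (SigmaEnv.mem (sigmaSet_range (α := β)) 2)))
    |>.ex 3 |>.ex 2 |>.ex 1).sigmaSet fun η => ?_
  simp only [PreTerm.val]
  constructor
  · rintro ⟨_, _, _, h, h', ⟨a, ha⟩, b, hb⟩
    refine ⟨((a, b), a), ?_, rfl⟩
    simp_all [code_pair]
  · rintro ⟨⟨⟨a, b⟩, c⟩, h, hc⟩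
    obtain rfl : c = a := hc
    exact ⟨code c, code b, code (c, b), by simpa [code_pair] using h.symm, by simp [code_pair],
      ⟨c, by simp⟩, b, by simp⟩

theorem SigmaFn.snd' : SigmaFn fun p : α × β => p.2 := by
  refine ((SigmaEnv.eq_pair (.var 0) (.var 6) (.var 4)).and
    ((SigmaEnv.eq_pair (.var 6) (.var 2) (.var 4)).and
    ((SigmaEnv.mem (sigmaSet_range (α := α)) 1).and (SigmaEnv.mem (sigmaSet_range (α := β)) 2)))
    |>.ex 3 |>.ex 2 |>.ex 1).sigmaSet fun η => ?_
  simp only [PreTerm.val]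
  constructor
  · rintro ⟨_, _, _, h, h', ⟨a, ha⟩, b, hb⟩
    refine ⟨((a, b), b), ?_, rfl⟩
    simp_all [code_pair]
  · rintro ⟨⟨⟨a, b⟩, c⟩, h, hc⟩
    obtain rfl : c = b := hc
    exact ⟨code a, code c, code (a, c), by simpa [code_pair] using h.symm, by simp [code_pair],
      ⟨a, by simp⟩, c, by simp⟩

@[fun_prop] theorem SigmaFn.fst {f : α → β × γ} (hf : SigmaFn f) : SigmaFn fun a => (f a).1 :=
  SigmaFn.fst'.comp hf

@[fun_prop] theorem SigmaFn.snd {f : α → β × γ} (hf : SigmaFn f) : SigmaFn fun a => (f a).2 :=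
  SigmaFn.snd'.comp hf

@[fun_prop] theorem SigmaFn.pair {f : α → β} {g : α → γ} (hf : SigmaFn f) (hg : SigmaFn g) :
    SigmaFn fun a => (f a, g a) := by
  refine ((SigmaEnv.eq_pair (.var 0) (.var 2) (.var 8)).and
    ((SigmaEnv.eq_pair (.var 8) (.var 4) (.var 6)).and
    ((SigmaEnv.mem_pair hf (.var 2) (.var 4)).and (SigmaEnv.mem_pair hg (.var 2) (.var 6))))
    |>.ex 4 |>.ex 3 |>.ex 2 |>.ex 1).sigmaSet fun η => ?_
  simp only [PreTerm.val, codes_graph_iff]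
  constructor
  · intro h
    obtain ⟨b, a, h1, h2⟩ : ∃ b a, η 0 = cantorPair (code a)
        (cantorPair (code (f a)) (code (g b))) ∧ code b = code a := by
      simpa using h
    obtain rfl := code_injective h2
    exact ⟨(b, (f b, g b)), h1.symm, rfl⟩
  · rintro ⟨⟨a, c⟩, h, hc⟩
    obtain rfl : c = (f a, g a) := hc
    suffices ∃ b a, η 0 = cantorPair (code a) (cantorPair (code (f a)) (code (g b))) ∧
      code b = code a by simpa using this
    exact ⟨a, a, h.symm, rfl⟩

@[fun_prop] theorem SigmaPred.eq {f g : α → β} (hf : SigmaFn f) (hg : SigmaFn g) :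
    SigmaPred fun a => f a = g a :=
  SigmaPred.comp (P := fun p : β × β => p.2 = p.1) SigmaFn.id (hg.pair hf)

/-- To prove that a function is `Σ`, it suffices to compute the codes of its values. -/
theorem SigmaFn.of_code {f : α → β} (h : SigmaFn fun a => code (f a)) : SigmaFn f := by
  refine SigmaEnv.sigmaSet (SigmaEnv.mem h 0) fun η => ?_
  constructor
  · rintro ⟨⟨a, n⟩, ha, h⟩
    obtain rfl : n = code (f a) := h
    exact ⟨(a, f a), ha, rfl⟩
  · rintro ⟨⟨a, b⟩, ha, h⟩
    obtain rfl : b = f a := h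
    exact ⟨(a, code (f a)), ha, rfl⟩

theorem SigmaFn.code' : SigmaFn (code : α → ℕ) := by
  refine SigmaEnv.sigmaSet (SigmaEnv.mem (SigmaFn.id (α := α)) 0) fun η => ?_
  constructor
  · rintro ⟨⟨a, b⟩, ha, h⟩
    obtain rfl : b = a := h
    exact ⟨(b, code b), ha, rfl⟩
  · rintro ⟨⟨a, n⟩, ha, h⟩
    obtain rfl : n = code a := h
    exact ⟨(a, a), ha, rfl⟩

@[fun_prop] theorem SigmaFn.code_comp {f : α → β} (hf : SigmaFn f) :
    SigmaFn fun a => SigmaType.code (f a) := SigmaFn.code'.comp hf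

/-- Functions given by a term in the variables `v₂` and `v₄` are `Σ`. -/
theorem SigmaFn.of_term {t : PreTerm} (ht : t.FV ⊆ {2, 4}) {f : ℕ → ℕ → ℕ}
    (h : ∀ η : ℕ → ℕ, t.val η = f (η 2) (η 4)) : SigmaFn fun p : ℕ × ℕ => f p.1 p.2 := by
  have ht6 : 6 ∉ t.FV := fun h => by simpa using ht h
  have ht8 : 8 ∉ t.FV := fun h => by simpa using ht h
  refine ((SigmaEnv.eq_pair (.var 0) (.var 6) (.var 8)).and
    ((SigmaEnv.eq_pair (.var 6) (.var 2) (.var 4)).and (SigmaEnv.eq (.var 8) t))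
    |>.ex 4 |>.ex 3 |>.ex 2 |>.ex 1).sigmaSet fun η => ?_
  simp only [PreTerm.val, h]
  constructor
  · intro h
    obtain ⟨a, b, h1⟩ : ∃ a b, η 0 = cantorPair (cantorPair a b) (f a b) := by simpa using h
    exact ⟨((a, b), f a b), h1.symm, rfl⟩
  · rintro ⟨⟨⟨a, b⟩, c⟩, h, hc⟩
    obtain rfl : c = f a b := hc
    suffices ∃ a b, η 0 = cantorPair (cantorPair a b) (f a b) by simpa using this
    exact ⟨a, b, h.symm⟩

@[fun_prop] theorem SigmaFn.add {f g : α → ℕ} (hf : SigmaFn f) (hg : SigmaFn g) :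
    SigmaFn fun a => f a + g a :=
  (SigmaFn.of_term (t := .add (.var 2) (.var 4)) (f := (· + ·)) (by simp [PreTerm.FV])
    fun η => rfl).comp (hf.pair hg)

@[fun_prop] theorem SigmaFn.mul {f g : α → ℕ} (hf : SigmaFn f) (hg : SigmaFn g) :
    SigmaFn fun a => f a * g a :=
  (SigmaFn.of_term (t := .mul (.var 2) (.var 4)) (f := (· * ·)) (by simp [PreTerm.FV])
    fun η => rfl).comp (hf.pair hg)

@[fun_prop] theorem SigmaPred.le {f g : α → ℕ} (hf : SigmaFn f) (hg : SigmaFn g) :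
    SigmaPred fun a => f a ≤ g a := by
  have : SigmaPred fun a => ∃ k, f a + k = g a := by fun_prop
  exact this.congr fun a => le_iff_exists_add.trans (by simp [eq_comm])

@[fun_prop] theorem SigmaPred.lt {f g : α → ℕ} (hf : SigmaFn f) (hg : SigmaFn g) :
    SigmaPred fun a => f a < g a := by
  have : SigmaPred fun a => f a + 1 ≤ g a := by fun_prop
  exact this.congr fun a => Iff.rfl

@[fun_prop] theorem SigmaFn.cantorPair {f g : α → ℕ} (hf : SigmaFn f) (hg : SigmaFn g) :
    SigmaFn fun a => cantorPair (f a) (g a) :=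
  SigmaFn.code'.comp (hf.pair hg)

/-- The modulus is a successor, so that the remainder is well-behaved; this covers the `β`-function. -/
@[fun_prop] theorem SigmaFn.mod_succ {f g : α → ℕ} (hf : SigmaFn f) (hg : SigmaFn g) :
    SigmaFn fun a => f a % (g a + 1) := by
  have : SigmaPred fun p : α × ℕ => ∃ q, q * (g p.1 + 1) + p.2 = f p.1 ∧ p.2 < g p.1 + 1 := by
    fun_prop
  refine this.congr fun p => ?_
  constructor
  · intro h
    rw [h]
    exact ⟨f p.1 / (g p.1 + 1), Nat.div_add_mod' _ _, Nat.mod_lt _ (Nat.succ_pos _)⟩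
  · rintro ⟨q, h, hlt⟩
    change p.2 = f p.1 % (g p.1 + 1)
    rw [← h, Nat.mul_add_mod_self_right, Nat.mod_eq_of_lt hlt]

/-- Bounded quantification, where the bound is the last component of the context. -/
theorem SigmaPred.ball_le {P : α × ℕ → ℕ → Prop}
    (hP : SigmaPred fun p : (α × ℕ) × ℕ => P p.1 p.2) :
    SigmaPred fun p : α × ℕ => ∀ i ≤ p.2, P p i := by
  have h6 : 2 * 3 ∉ (PreTerm.var 4).FV := by simp [PreTerm.FV]
  refine ((SigmaEnv.eq_pair (.var 0) (.var 2) (.var 4)).and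
    ((SigmaEnv.mem_pair hP (.var 0) (.var 6)).ball 3 (.var 4) h6) |>.ex 2 |>.ex 1).sigmaSet
    fun η => ?_
  simp only [PreTerm.val]
  trans ∃ m n, η 0 = FOArith.cantorPair m n ∧ ∀ i ≤ n,
    Codes (fun p : (α × ℕ) × ℕ => P p.1 p.2) (FOArith.cantorPair (η 0) i)
  · simp
  constructor
  · rintro ⟨m, n, h, hall⟩
    obtain ⟨⟨⟨a, b⟩, i⟩, hab, -⟩ := hall 0 (Nat.zero_le _)
    obtain ⟨h1, -⟩ := cantorPair_inj.1 hab
    refine ⟨(a, b), h1, fun i hi => ?_⟩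
    have hb : b = n := (cantorPair_inj.1 (h1.trans h)).2
    have := hall i (hb ▸ hi)
    rw [← h1] at this
    exact (codes_code (fun p : (α × ℕ) × ℕ => P p.1 p.2) ((a, b), i)).1 this
  · rintro ⟨⟨a, b⟩, h, hall⟩
    refine ⟨SigmaType.code a, b, h.symm, fun i hi => ⟨((a, b), i), ?_, hall i hi⟩⟩
    rw [← h]
    rfl

@[fun_prop] theorem SigmaPred.ball {P : α → ℕ → Prop} {f : α → ℕ} (hf : SigmaFn f)
    (hP : SigmaPred fun p : α × ℕ => P p.1 p.2) : SigmaPred fun a => ∀ i < f a, P a i := by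
  have h1 : SigmaPred fun p : (α × ℕ) × ℕ => p.1.2 ≤ p.2 ∨ P p.1.1 p.2 :=
    SigmaPred.or (by fun_prop) (hP.comp (f := fun p : (α × ℕ) × ℕ => (p.1.1, p.2)) (by fun_prop))
  have h2 := (SigmaPred.ball_le (P := fun p i => p.2 ≤ i ∨ P p.1 i) h1).comp
    (f := fun a => (a, f a)) (by fun_prop)
  refine h2.congr fun a => ⟨fun h i _ => (le_or_gt (f a) i).imp_right (h i), fun h i hi => ?_⟩
  exact (h i hi.le).resolve_left (by simpa using hi)

/-! ### Inductively defined `Σ`-predicates -/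

/-- The least predicate that contains `Ax` and is closed under the rules with conclusion `a` and
premises `b` and `c`, for `R a b c`. -/
inductive Gen (Ax : α → Prop) (R : α → α → α → Prop) : α → Prop
  | ax {a : α} (h : Ax a) : Gen Ax R a
  | rule {a b c : α} (hb : Gen Ax R b) (hc : Gen Ax R c) (h : R a b c) : Gen Ax R a

/-- An element is generated if it is the last entry of a finite sequence of which each entry is an
axiom or follows from earlier entries. -/
theorem Gen.exists_list {α : Type} {Ax : α → Prop} {R : α → α → α → Prop} {a : α} (h : Gen Ax R a) :
    ∃ l : List α, (∀ (i : ℕ) b, l[i]? = some b → Ax b ∨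
      ∃ j < i, ∃ k < i, ∃ c d, l[j]? = some c ∧ l[k]? = some d ∧ R b c d) ∧
      ∃ i : ℕ, l[i]? = some a := by
  induction h with
  | @ax a h =>
    refine ⟨[a], fun i b hi => .inl ?_, 0, rfl⟩
    rw [List.getElem?_singleton] at hi
    grind
  | @rule a b c _ _ h ihb ihc =>
    obtain ⟨l₁, h₁, m, hm⟩ := ihb
    obtain ⟨l₂, h₂, n, hn⟩ := ihc
    have hm' : m < l₁.length := (List.getElem?_eq_some_iff.1 hm).1
    have hn' : n < l₂.length := (List.getElem?_eq_some_iff.1 hn).1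
    refine ⟨l₁ ++ (l₂ ++ [a]), fun i b hi => ?_, l₁.length + l₂.length, by
      simp⟩
    rcases lt_or_ge i l₁.length with hlt | hge
    · rw [List.getElem?_append_left hlt] at hi
      refine (h₁ i b hi).imp_right ?_
      rintro ⟨j, hj, k, hk, c, d, hc, hd, hR⟩
      exact ⟨j, hj, k, hk, c, d, by rw [List.getElem?_append_left (hj.trans hlt), hc],
        by rw [List.getElem?_append_left (hk.trans hlt), hd], hR⟩
    · obtain ⟨i, rfl⟩ := Nat.exists_eq_add_of_le hge
      have hshift : ∀ j < l₂.length, (l₁ ++ (l₂ ++ [a]))[l₁.length + j]? = l₂[j]? := by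
        intro j hj
        rw [List.getElem?_append_right (Nat.le_add_right _ _), Nat.add_sub_cancel_left,
          List.getElem?_append_left hj]
      rcases lt_or_ge i l₂.length with hlt | hge
      · rw [hshift i hlt] at hi
        refine (h₂ i b hi).imp_right ?_
        rintro ⟨j, hj, k, hk, c, d, hc, hd, hR⟩
        exact ⟨l₁.length + j, by omega, l₁.length + k, by omega, c, d,
          by rw [hshift j (by omega), hc], by rw [hshift k (by omega), hd], hR⟩
      · have hlt := (List.getElem?_eq_some_iff.1 hi).1
        simp only [List.length_append, List.length_singleton] at hlt
        obtain rfl : i = l₂.length := by omega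
        obtain rfl : a = b := by simpa using hi
        exact .inr ⟨m, by omega, l₁.length + n, by omega, _, _,
          by rw [List.getElem?_append_left hm', hm], by rw [hshift n hn', hn], h⟩

/-- Gödel's `β`-function codes the finite sequences of natural numbers. -/
theorem exists_beta (l : List ℕ) :
    ∃ s d, ∀ i (h : i < l.length), s % ((i + 1) * d + 1) = l[i] :=
  ⟨_, _, fun i h => Nat.beta_unbeta_coe l ⟨i, h⟩⟩

/-- `Σ`-predicates are closed under inductive definitions. -/
theorem SigmaPred.gen {Ax : α → Prop} {R : α → α → α → Prop} (hAx : SigmaPred Ax)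
    (hR : SigmaPred fun p : α × α × α => R p.1 p.2.1 p.2.2) : SigmaPred (Gen Ax R) := by
  -- `Ax` and `R` are composed by hand, as `fun_prop` does not see through variables for predicates.
  have hAx' : ∀ {δ : Type} [SigmaType δ] {f : δ → α}, SigmaFn f → SigmaPred fun x => Ax (f x) :=
    fun hf => hAx.comp hf
  have hR' : ∀ {δ : Type} [SigmaType δ] {f g h : δ → α}, SigmaFn f → SigmaFn g → SigmaFn h →
      SigmaPred fun x => R (f x) (g x) (h x) := fun hf hg hh => hR.comp (hf.pair (hg.pair hh))
  -- The pair `s`, `d` codes a sequence by the `β`-function, and `a` is its entry with index `k`.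
  have h1 : SigmaPred fun a : α => ∃ s d k : ℕ, s % ((k + 1) * d + 1) = code a ∧ ∀ i < k + 1, ∃ b : α,
      code b = s % ((i + 1) * d + 1) ∧ (Ax b ∨ ∃ m, m < i ∧ ∃ n, n < i ∧ ∃ c c' : α,
        code c = s % ((m + 1) * d + 1) ∧ code c' = s % ((n + 1) * d + 1) ∧ R b c c') := by
    refine .ex (.ex (.ex (.and (by fun_prop) (.ball (by fun_prop) (.ex (.and (by fun_prop)
      (.or (hAx' (by fun_prop)) (.ex (.and (by fun_prop) (.ex (.and (by fun_prop) (.ex (.ex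
      (.and (by fun_prop) (.and (by fun_prop) (hR' ?_ ?_ ?_)))))))))))))))) <;> fun_prop
  refine h1.congr fun a => ?_
  constructor
  · intro h
    obtain ⟨l, hl, k, hk⟩ := h.exists_list
    obtain ⟨s, d, hsd⟩ := exists_beta (l.map code)
    have hsd' : ∀ (i : ℕ) b, l[i]? = some b → s % ((i + 1) * d + 1) = code b := by
      intro i b hi
      obtain ⟨h, hb⟩ := List.getElem?_eq_some_iff.1 hi
      rw [hsd i (by simpa using h), List.getElem_map, hb]
    have hk' := (List.getElem?_eq_some_iff.1 hk).1
    refine ⟨s, d, k, hsd' k a hk, fun i hi => ?_⟩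
    have hi' : l[i]? = some l[i] := List.getElem?_eq_getElem (by omega)
    refine ⟨l[i], (hsd' i _ hi').symm, (hl i _ hi').imp_right ?_⟩
    rintro ⟨j, hj, k, hk, c, d, hc, hd, hR⟩
    exact ⟨j, hj, k, hk, c, d, (hsd' j c hc).symm, (hsd' k d hd).symm, hR⟩
  · rintro ⟨s, d, k, hk, h⟩
    have key : ∀ i < k + 1, ∀ b : α, code b = s % ((i + 1) * d + 1) → Gen Ax R b := by
      intro i
      induction i using Nat.strong_induction_on with
      | _ i ih =>
        intro hi b hb
        obtain ⟨b', hb', h'⟩ := h i hi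
        obtain rfl : b = b' := code_injective (hb.trans hb'.symm)
        rcases h' with h' | ⟨m, hm, n, hn, c, c', hc, hc', hR⟩
        · exact .ax h'
        · exact .rule (ih m hm (by omega) c hc) (ih n hn (by omega) c' hc') hR
    exact key k (Nat.lt_succ_self k) a hk.symm

variable {α β γ : Type} [SigmaType α] [SigmaType β] [SigmaType γ]

/-! ### Syntactic operations are `Σ` -/

/-- A predicate is `Σ` if it is the least one closed under given `Σ`-rules. -/
theorem SigmaPred.of_gen {P Ax : α → Prop} {R : α → α → α → Prop} (hAx : SigmaPred Ax)
    (hR : SigmaPred fun p : α × α × α => R p.1 p.2.1 p.2.2) (h₁ : ∀ a, Ax a → P a)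
    (h₂ : ∀ a b c, R a b c → P b → P c → P a) (h₃ : ∀ a, P a → Gen Ax R a) : SigmaPred P := by
  refine (SigmaPred.gen hAx hR).congr fun a => ⟨h₃ a, fun h => ?_⟩
  induction h with
  | ax h => exact h₁ _ h
  | rule _ _ h hb hc => exact h₂ _ _ _ h hb hc

theorem SigmaPred.sigmaSet {P : ℕ → Prop} (h : SigmaPred P) : SigmaSet P :=
  SigmaEnv.sigmaSet (SigmaEnv.mem h 0) fun η => by
    simp only [Codes, code_nat, exists_eq_left, mul_zero]

@[fun_prop] theorem SigmaPred.ne {f g : α → ℕ} (hf : SigmaFn f) (hg : SigmaFn g) :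
    SigmaPred fun a => f a ≠ g a := by
  have : SigmaPred fun a => f a < g a ∨ g a < f a := by fun_prop
  exact this.congr fun a => lt_or_lt_iff_ne.symm

instance : SigmaType PreTerm where
  code := PreTerm.godelNum
  code_injective := PreTerm.godelNum_injective
  sigmaSet_range := by
    refine (SigmaPred.of_gen (Ax := fun n => (∃ i, n = seqCode [0, 0, i]) ∨ n = seqCode [0, 1])
      (R := fun n a b => n = seqCode [0, 2, a] ∨ n = seqCode [0, 3, a, b] ∨
        n = seqCode [0, 4, a, b]) ?_ ?_ ?_ ?_ ?_).sigmaSet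
    · simp only [seqCode, List.foldl_cons, List.foldl_nil]
      fun_prop
    · simp only [seqCode, List.foldl_cons, List.foldl_nil]
      fun_prop
    · rintro a (⟨i, rfl⟩ | rfl)
      exacts [⟨.var i, rfl⟩, ⟨.zero, rfl⟩]
    · rintro _ _ _ (rfl | rfl | rfl) ⟨s, rfl⟩ ⟨t, rfl⟩
      exacts [⟨.succ s, rfl⟩, ⟨.add s t, rfl⟩, ⟨.mul s t, rfl⟩]
    · rintro _ ⟨t, rfl⟩
      induction t with
      | var i => exact .ax (.inl ⟨i, rfl⟩)
      | zero => exact .ax (.inr rfl)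
      | succ t ih => exact .rule ih ih (.inl rfl)
      | add s t h1 h2 => exact .rule h1 h2 (.inr (.inl rfl))
      | mul s t h1 h2 => exact .rule h1 h2 (.inr (.inr rfl))

@[fun_prop] theorem SigmaFn.var {f : α → ℕ} (hf : SigmaFn f) :
    SigmaFn fun a => PreTerm.var (f a) := by
  refine .of_code (show SigmaFn fun a => seqCode [0, 0, f a] from ?_)
  simp only [seqCode, List.foldl_cons, List.foldl_nil]
  fun_prop

@[fun_prop] theorem SigmaFn.succ {f : α → PreTerm} (hf : SigmaFn f) :
    SigmaFn fun a => PreTerm.succ (f a) := by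
  refine .of_code (show SigmaFn fun a => seqCode [0, 2, code (f a)] from ?_)
  simp only [seqCode, List.foldl_cons, List.foldl_nil]
  fun_prop

@[fun_prop] theorem SigmaFn.termAdd {f : α → PreTerm} (hf : SigmaFn f)
    {g : α → PreTerm} (hg : SigmaFn g) :
    SigmaFn fun a => PreTerm.add (f a) (g a) := by
  refine .of_code (show SigmaFn fun a => seqCode [0, 3, code (f a), code (g a)] from ?_)
  simp only [seqCode, List.foldl_cons, List.foldl_nil]
  fun_prop

@[fun_prop] theorem SigmaFn.termMul {f : α → PreTerm} (hf : SigmaFn f)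
    {g : α → PreTerm} (hg : SigmaFn g) :
    SigmaFn fun a => PreTerm.mul (f a) (g a) := by
  refine .of_code (show SigmaFn fun a => seqCode [0, 4, code (f a), code (g a)] from ?_)
  simp only [seqCode, List.foldl_cons, List.foldl_nil]
  fun_prop

instance : SigmaType PreFormula where
  code := PreFormula.godelNum
  code_injective := PreFormula.godelNum_injective
  sigmaSet_range := by
    refine (SigmaPred.of_gen
      (Ax := fun n => ∃ s t : PreTerm, n = seqCode [1, 0, code s, code t] ∨
        n = seqCode [1, 1, code s, code t] ∨ n = seqCode [1, 2, code s, code t] ∨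
        n = seqCode [1, 3, code s, code t])
      (R := fun n a b => n = seqCode [1, 4, a, b] ∨ n = seqCode [1, 5, a, b] ∨
        ∃ i, n = seqCode [1, 6, 2 * i, a] ∨ n = seqCode [1, 7, 2 * i, a]) ?_ ?_ ?_ ?_ ?_).sigmaSet
    · simp only [seqCode, List.foldl_cons, List.foldl_nil]
      fun_prop
    · simp only [seqCode, List.foldl_cons, List.foldl_nil]
      fun_prop
    · rintro _ ⟨s, t, rfl | rfl | rfl | rfl⟩
      exacts [⟨.eq s t, rfl⟩, ⟨.ne s t, rfl⟩, ⟨.le s t, rfl⟩, ⟨.nle s t, rfl⟩]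
    · rintro _ _ _ (rfl | rfl | ⟨i, rfl | rfl⟩) ⟨φ, rfl⟩ ⟨ψ, rfl⟩
      exacts [⟨.and φ ψ, rfl⟩, ⟨.or φ ψ, rfl⟩, ⟨.all i φ, rfl⟩, ⟨.ex i φ, rfl⟩]
    · rintro _ ⟨φ, rfl⟩
      induction φ with
      | eq s t => exact .ax ⟨s, t, .inl rfl⟩
      | ne s t => exact .ax ⟨s, t, .inr (.inl rfl)⟩
      | le s t => exact .ax ⟨s, t, .inr (.inr (.inl rfl))⟩
      | nle s t => exact .ax ⟨s, t, .inr (.inr (.inr rfl))⟩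
      | and φ ψ h1 h2 => exact .rule h1 h2 (.inl rfl)
      | or φ ψ h1 h2 => exact .rule h1 h2 (.inr (.inl rfl))
      | all i φ ih => exact .rule ih ih (.inr (.inr ⟨i, .inl rfl⟩))
      | ex i φ ih => exact .rule ih ih (.inr (.inr ⟨i, .inr rfl⟩))

@[fun_prop] theorem SigmaFn.eq {f : α → PreTerm} (hf : SigmaFn f)
    {g : α → PreTerm} (hg : SigmaFn g) :
    SigmaFn fun a => PreFormula.eq (f a) (g a) := by
  refine .of_code (show SigmaFn fun a => seqCode [1, 0, code (f a), code (g a)] from ?_)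
  simp only [seqCode, List.foldl_cons, List.foldl_nil]
  fun_prop

@[fun_prop] theorem SigmaFn.ne {f : α → PreTerm} (hf : SigmaFn f)
    {g : α → PreTerm} (hg : SigmaFn g) :
    SigmaFn fun a => PreFormula.ne (f a) (g a) := by
  refine .of_code (show SigmaFn fun a => seqCode [1, 1, code (f a), code (g a)] from ?_)
  simp only [seqCode, List.foldl_cons, List.foldl_nil]
  fun_prop

@[fun_prop] theorem SigmaFn.le {f : α → PreTerm} (hf : SigmaFn f)
    {g : α → PreTerm} (hg : SigmaFn g) :
    SigmaFn fun a => PreFormula.le (f a) (g a) := by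
  refine .of_code (show SigmaFn fun a => seqCode [1, 2, code (f a), code (g a)] from ?_)
  simp only [seqCode, List.foldl_cons, List.foldl_nil]
  fun_prop

@[fun_prop] theorem SigmaFn.nle {f : α → PreTerm} (hf : SigmaFn f)
    {g : α → PreTerm} (hg : SigmaFn g) :
    SigmaFn fun a => PreFormula.nle (f a) (g a) := by
  refine .of_code (show SigmaFn fun a => seqCode [1, 3, code (f a), code (g a)] from ?_)
  simp only [seqCode, List.foldl_cons, List.foldl_nil]
  fun_prop

@[fun_prop] theorem SigmaFn.and {f : α → PreFormula} (hf : SigmaFn f)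
    {g : α → PreFormula} (hg : SigmaFn g) :
    SigmaFn fun a => PreFormula.and (f a) (g a) := by
  refine .of_code (show SigmaFn fun a => seqCode [1, 4, code (f a), code (g a)] from ?_)
  simp only [seqCode, List.foldl_cons, List.foldl_nil]
  fun_prop

@[fun_prop] theorem SigmaFn.or {f : α → PreFormula} (hf : SigmaFn f)
    {g : α → PreFormula} (hg : SigmaFn g) :
    SigmaFn fun a => PreFormula.or (f a) (g a) := by
  refine .of_code (show SigmaFn fun a => seqCode [1, 5, code (f a), code (g a)] from ?_)
  simp only [seqCode, List.foldl_cons, List.foldl_nil]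
  fun_prop

@[fun_prop] theorem SigmaFn.all {f : α → ℕ} (hf : SigmaFn f)
    {g : α → PreFormula} (hg : SigmaFn g) :
    SigmaFn fun a => PreFormula.all (f a) (g a) := by
  refine .of_code (show SigmaFn fun a => seqCode [1, 6, 2 * f a, code (g a)] from ?_)
  simp only [seqCode, List.foldl_cons, List.foldl_nil]
  fun_prop

@[fun_prop] theorem SigmaFn.ex {f : α → ℕ} (hf : SigmaFn f)
    {g : α → PreFormula} (hg : SigmaFn g) :
    SigmaFn fun a => PreFormula.ex (f a) (g a) := by
  refine .of_code (show SigmaFn fun a => seqCode [1, 7, 2 * f a, code (g a)] from ?_)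
  simp only [seqCode, List.foldl_cons, List.foldl_nil]
  fun_prop

@[fun_prop] theorem SigmaFn.numeral {f : α → ℕ} (hf : SigmaFn f) :
    SigmaFn fun a => numeral (f a) := by
  refine SigmaFn.comp (f := FOArith.numeral) (SigmaPred.of_gen
    (Ax := fun p : ℕ × PreTerm => p = (0, .zero))
    (R := fun p q _ => p = (q.1 + 1, .succ q.2)) ?_ ?_ ?_ ?_ ?_) hf
  · fun_prop
  · fun_prop
  · rintro _ rfl
    rfl
  · rintro _ ⟨n, t⟩ _ rfl h _
    exact congrArg PreTerm.succ h
  · rintro ⟨n, t⟩ h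
    obtain rfl : t = FOArith.numeral n := h
    induction n with
    | zero => exact .ax rfl
    | succ n ih => exact .rule ih ih rfl

theorem SigmaPred.notMem_FV_preTerm : SigmaPred fun p : ℕ × PreTerm => p.1 ∉ p.2.FV := by
  refine SigmaPred.of_gen
    (Ax := fun p => (∃ i, p.2 = .var i ∧ p.1 ≠ i) ∨ p.2 = .zero)
    (R := fun p q r => q.1 = p.1 ∧ r.1 = p.1 ∧ (p.2 = .succ q.2 ∨ p.2 = .add q.2 r.2 ∨
      p.2 = .mul q.2 r.2)) ?_ ?_ ?_ ?_ ?_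
  · fun_prop
  · fun_prop
  · rintro ⟨y, _⟩ (⟨i, rfl, h⟩ | rfl)
    · simpa [PreTerm.FV] using h
    · simp [PreTerm.FV]
  · rintro ⟨y, _⟩ ⟨_, s⟩ ⟨_, t⟩ ⟨rfl, rfl, rfl | rfl | rfl⟩ h1 h2 <;> simp_all [PreTerm.FV]
  · rintro ⟨y, t⟩ h
    induction t with
    | var i => exact .ax (.inl ⟨i, rfl, by simpa [PreTerm.FV] using h⟩)
    | zero => exact .ax (.inr rfl)
    | succ t ih => exact .rule (ih h) (ih h) ⟨rfl, rfl, .inl rfl⟩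
    | add s t h1 h2 =>
      simp only [PreTerm.FV, Finset.mem_union, not_or] at h
      exact .rule (h1 h.1) (h2 h.2) ⟨rfl, rfl, .inr (.inl rfl)⟩
    | mul s t h1 h2 =>
      simp only [PreTerm.FV, Finset.mem_union, not_or] at h
      exact .rule (h1 h.1) (h2 h.2) ⟨rfl, rfl, .inr (.inr rfl)⟩

@[fun_prop] theorem SigmaPred.notMem_FV_term {f : α → ℕ} {g : α → PreTerm} (hf : SigmaFn f)
    (hg : SigmaFn g) : SigmaPred fun a => f a ∉ (g a).FV :=
  SigmaPred.notMem_FV_preTerm.comp (f := fun a => (f a, g a)) (by fun_prop)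

theorem SigmaPred.notMem_FV_preFormula : SigmaPred fun p : ℕ × PreFormula => p.1 ∉ p.2.FV := by
  refine SigmaPred.of_gen
    (Ax := fun p => (∃ s t, (p.2 = .eq s t ∨ p.2 = .ne s t ∨ p.2 = .le s t ∨ p.2 = .nle s t) ∧
        p.1 ∉ s.FV ∧ p.1 ∉ t.FV) ∨
      ∃ i φ, (p.2 = .all i φ ∨ p.2 = .ex i φ) ∧ p.1 = 2 * i)
    (R := fun p q r => q.1 = p.1 ∧ r.1 = p.1 ∧ (p.2 = .and q.2 r.2 ∨ p.2 = .or q.2 r.2 ∨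
      ∃ i, p.2 = .all i q.2 ∨ p.2 = .ex i q.2)) ?_ ?_ ?_ ?_ ?_
  · fun_prop
  · fun_prop
  · rintro ⟨y, _⟩ (⟨s, t, rfl | rfl | rfl | rfl, h, h'⟩ | ⟨i, φ, rfl | rfl, h⟩) <;>
      simp_all [PreFormula.FV]
  · rintro ⟨y, _⟩ ⟨_, φ⟩ ⟨_, ψ⟩ ⟨rfl, rfl, rfl | rfl | ⟨i, rfl | rfl⟩⟩ h1 h2 <;>
      simp_all [PreFormula.FV]
  · rintro ⟨y, φ⟩ h
    induction φ with
    | eq s t =>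
      simp only [PreFormula.FV, Finset.mem_union, not_or] at h
      exact .ax (.inl ⟨s, t, .inl rfl, h⟩)
    | ne s t =>
      simp only [PreFormula.FV, Finset.mem_union, not_or] at h
      exact .ax (.inl ⟨s, t, .inr (.inl rfl), h⟩)
    | le s t =>
      simp only [PreFormula.FV, Finset.mem_union, not_or] at h
      exact .ax (.inl ⟨s, t, .inr (.inr (.inl rfl)), h⟩)
    | nle s t =>
      simp only [PreFormula.FV, Finset.mem_union, not_or] at h
      exact .ax (.inl ⟨s, t, .inr (.inr (.inr rfl)), h⟩)
    | and φ ψ h1 h2 =>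
      simp only [PreFormula.FV, Finset.mem_union, not_or] at h
      exact .rule (h1 h.1) (h2 h.2) ⟨rfl, rfl, .inl rfl⟩
    | or φ ψ h1 h2 =>
      simp only [PreFormula.FV, Finset.mem_union, not_or] at h
      exact .rule (h1 h.1) (h2 h.2) ⟨rfl, rfl, .inr (.inl rfl)⟩
    | all i φ ih =>
      by_cases hy : y = 2 * i
      · exact .ax (.inr ⟨i, φ, .inl rfl, hy⟩)
      · have h' := ih fun h' => h (Finset.mem_erase.2 ⟨hy, h'⟩)
        exact .rule h' h' ⟨rfl, rfl, .inr (.inr ⟨i, .inl rfl⟩)⟩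
    | ex i φ ih =>
      by_cases hy : y = 2 * i
      · exact .ax (.inr ⟨i, φ, .inr rfl, hy⟩)
      · have h' := ih fun h' => h (Finset.mem_erase.2 ⟨hy, h'⟩)
        exact .rule h' h' ⟨rfl, rfl, .inr (.inr ⟨i, .inr rfl⟩)⟩

@[fun_prop] theorem SigmaPred.notMem_FV {f : α → ℕ} {g : α → PreFormula} (hf : SigmaFn f)
    (hg : SigmaFn g) : SigmaPred fun a => f a ∉ (g a).FV :=
  SigmaPred.notMem_FV_preFormula.comp (f := fun a => (f a, g a)) (by fun_prop)

theorem SigmaFn.preTerm_subst :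
    SigmaFn fun p : (ℕ × PreTerm) × PreTerm => p.2.subst p.1.1 p.1.2 := by
  refine SigmaPred.of_gen (α := ((ℕ × PreTerm) × PreTerm) × PreTerm)
    (Ax := fun p => (∃ j, p.1.2 = .var j ∧ ((p.1.1.1 = j ∧ p.2 = p.1.1.2) ∨
      (p.1.1.1 ≠ j ∧ p.2 = .var j))) ∨ (p.1.2 = .zero ∧ p.2 = .zero))
    (R := fun p q r => q.1.1 = p.1.1 ∧ r.1.1 = p.1.1 ∧
      ((p.1.2 = .succ q.1.2 ∧ p.2 = .succ q.2) ∨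
      (p.1.2 = .add q.1.2 r.1.2 ∧ p.2 = .add q.2 r.2) ∨
      (p.1.2 = .mul q.1.2 r.1.2 ∧ p.2 = .mul q.2 r.2))) ?_ ?_ ?_ ?_ ?_
  · fun_prop
  · fun_prop
  · rintro ⟨⟨⟨i, t⟩, s⟩, u⟩ (⟨j, h, ⟨h1, h2⟩ | ⟨h1, h2⟩⟩ | ⟨h1, h2⟩) <;>
      simp_all [PreTerm.subst]
  · rintro ⟨⟨⟨i, t⟩, s⟩, u⟩ ⟨⟨_, s₁⟩, u₁⟩ ⟨⟨_, s₂⟩, u₂⟩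
      ⟨rfl, rfl, ⟨h1, h2⟩ | ⟨h1, h2⟩ | ⟨h1, h2⟩⟩ h3 h4 <;> simp_all [PreTerm.subst]
  · rintro ⟨⟨⟨i, t⟩, s⟩, u⟩ h
    obtain rfl : u = s.subst i t := h
    induction s with
    | var j =>
      refine .ax (.inl ⟨j, rfl, ?_⟩)
      by_cases h : i = j <;> simp [PreTerm.subst, h]
    | zero => exact .ax (.inr ⟨rfl, rfl⟩)
    | succ s ih => exact .rule ih ih ⟨rfl, rfl, .inl ⟨rfl, rfl⟩⟩
    | add s₁ s₂ h1 h2 => exact .rule h1 h2 ⟨rfl, rfl, .inr (.inl ⟨rfl, rfl⟩)⟩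
    | mul s₁ s₂ h1 h2 => exact .rule h1 h2 ⟨rfl, rfl, .inr (.inr ⟨rfl, rfl⟩)⟩

@[fun_prop] theorem SigmaFn.substTerm {f : α → ℕ} {g h : α → PreTerm} (hf : SigmaFn f)
    (hg : SigmaFn g) (hh : SigmaFn h) : SigmaFn fun a => PreTerm.subst (h a) (f a) (g a) :=
  SigmaFn.preTerm_subst.comp (g := fun a => ((f a, g a), h a)) (by fun_prop)

theorem SigmaFn.preFormula_subst :
    SigmaFn fun p : (ℕ × PreTerm) × PreFormula => p.2.subst p.1.1 p.1.2 := by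
  refine SigmaPred.of_gen (α := ((ℕ × PreTerm) × PreFormula) × PreFormula)
    (Ax := fun p =>
      (∃ s t, (p.1.2 = .eq s t ∧ p.2 = .eq (s.subst p.1.1.1 p.1.1.2) (t.subst p.1.1.1 p.1.1.2)) ∨
        (p.1.2 = .ne s t ∧ p.2 = .ne (s.subst p.1.1.1 p.1.1.2) (t.subst p.1.1.1 p.1.1.2)) ∨
        (p.1.2 = .le s t ∧ p.2 = .le (s.subst p.1.1.1 p.1.1.2) (t.subst p.1.1.1 p.1.1.2)) ∨
        (p.1.2 = .nle s t ∧ p.2 = .nle (s.subst p.1.1.1 p.1.1.2) (t.subst p.1.1.1 p.1.1.2))) ∨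
      ∃ j φ, p.1.1.1 = 2 * j ∧ (p.1.2 = .all j φ ∨ p.1.2 = .ex j φ) ∧ p.2 = p.1.2)
    (R := fun p q r => q.1.1 = p.1.1 ∧ r.1.1 = p.1.1 ∧
      ((p.1.2 = .and q.1.2 r.1.2 ∧ p.2 = .and q.2 r.2) ∨
      (p.1.2 = .or q.1.2 r.1.2 ∧ p.2 = .or q.2 r.2) ∨
      ∃ j, p.1.1.1 ≠ 2 * j ∧ ((p.1.2 = .all j q.1.2 ∧ p.2 = .all j q.2) ∨
        (p.1.2 = .ex j q.1.2 ∧ p.2 = .ex j q.2)))) ?_ ?_ ?_ ?_ ?_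
  · fun_prop
  · fun_prop
  · rintro ⟨⟨⟨i, t⟩, χ⟩, χ'⟩ (⟨s, u, ⟨h1, h2⟩ | ⟨h1, h2⟩ | ⟨h1, h2⟩ | ⟨h1, h2⟩⟩ |
      ⟨j, φ, h1, h2 | h2, h3⟩) <;> simp_all [PreFormula.subst]
  · rintro ⟨⟨⟨i, t⟩, χ⟩, χ'⟩ ⟨⟨_, φ⟩, φ'⟩ ⟨⟨_, ψ⟩, ψ'⟩
      ⟨rfl, rfl, ⟨h1, h2⟩ | ⟨h1, h2⟩ | ⟨j, h0, ⟨h1, h2⟩ | ⟨h1, h2⟩⟩⟩ h3 h4 <;>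
      simp_all [PreFormula.subst]
  · rintro ⟨⟨⟨i, t⟩, φ⟩, χ⟩ h
    obtain rfl : χ = φ.subst i t := h
    induction φ with
    | eq s u => exact .ax (.inl ⟨s, u, .inl ⟨rfl, rfl⟩⟩)
    | ne s u => exact .ax (.inl ⟨s, u, .inr (.inl ⟨rfl, rfl⟩)⟩)
    | le s u => exact .ax (.inl ⟨s, u, .inr (.inr (.inl ⟨rfl, rfl⟩))⟩)
    | nle s u => exact .ax (.inl ⟨s, u, .inr (.inr (.inr ⟨rfl, rfl⟩))⟩)
    | and φ ψ h1 h2 => exact .rule h1 h2 ⟨rfl, rfl, .inl ⟨rfl, rfl⟩⟩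
    | or φ ψ h1 h2 => exact .rule h1 h2 ⟨rfl, rfl, .inr (.inl ⟨rfl, rfl⟩)⟩
    | all j φ ih =>
      by_cases h : i = 2 * j
      · exact .ax (.inr ⟨j, φ, h, .inl rfl, by simp [PreFormula.subst, h]⟩)
      · refine .rule ih ih ⟨rfl, rfl, .inr (.inr ⟨j, h, .inl ⟨rfl, ?_⟩⟩)⟩
        simp [PreFormula.subst, h]
    | ex j φ ih =>
      by_cases h : i = 2 * j
      · exact .ax (.inr ⟨j, φ, h, .inr rfl, by simp [PreFormula.subst, h]⟩)
      · refine .rule ih ih ⟨rfl, rfl, .inr (.inr ⟨j, h, .inr ⟨rfl, ?_⟩⟩)⟩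
        simp [PreFormula.subst, h]

@[fun_prop] theorem SigmaFn.subst {f : α → ℕ} {g : α → PreTerm} {h : α → PreFormula}
    (hf : SigmaFn f) (hg : SigmaFn g) (hh : SigmaFn h) :
    SigmaFn fun a => PreFormula.subst (h a) (f a) (g a) :=
  SigmaFn.preFormula_subst.comp (g := fun a => ((f a, g a), h a)) (by fun_prop)

theorem SigmaFn.neg' : SigmaFn PreFormula.neg := by
  refine SigmaPred.of_gen (α := PreFormula × PreFormula)
    (Ax := fun p => ∃ s t, (p.1 = .eq s t ∧ p.2 = .ne s t) ∨ (p.1 = .ne s t ∧ p.2 = .eq s t) ∨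
      (p.1 = .le s t ∧ p.2 = .nle s t) ∨ (p.1 = .nle s t ∧ p.2 = .le s t))
    (R := fun p q r => (p.1 = .and q.1 r.1 ∧ p.2 = .or q.2 r.2) ∨
      (p.1 = .or q.1 r.1 ∧ p.2 = .and q.2 r.2) ∨
      ∃ i, (p.1 = .all i q.1 ∧ p.2 = .ex i q.2) ∨ (p.1 = .ex i q.1 ∧ p.2 = .all i q.2))
    ?_ ?_ ?_ ?_ ?_
  · fun_prop
  · fun_prop
  · rintro ⟨χ, χ'⟩ ⟨s, t, ⟨h1, h2⟩ | ⟨h1, h2⟩ | ⟨h1, h2⟩ | ⟨h1, h2⟩⟩ <;>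
      simp_all [PreFormula.neg]
  · rintro ⟨χ, χ'⟩ ⟨φ, φ'⟩ ⟨ψ, ψ'⟩ (⟨h1, h2⟩ | ⟨h1, h2⟩ | ⟨i, ⟨h1, h2⟩ | ⟨h1, h2⟩⟩) h3 h4 <;>
      simp_all [PreFormula.neg]
  · rintro ⟨φ, χ⟩ h
    obtain rfl : χ = φ.neg := h
    induction φ with
    | eq s u => exact .ax ⟨s, u, .inl ⟨rfl, rfl⟩⟩
    | ne s u => exact .ax ⟨s, u, .inr (.inl ⟨rfl, rfl⟩)⟩
    | le s u => exact .ax ⟨s, u, .inr (.inr (.inl ⟨rfl, rfl⟩))⟩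
    | nle s u => exact .ax ⟨s, u, .inr (.inr (.inr ⟨rfl, rfl⟩))⟩
    | and φ ψ h1 h2 => exact .rule h1 h2 (.inl ⟨rfl, rfl⟩)
    | or φ ψ h1 h2 => exact .rule h1 h2 (.inr (.inl ⟨rfl, rfl⟩))
    | all j φ ih => exact .rule ih ih (.inr (.inr ⟨j, .inl ⟨rfl, rfl⟩⟩))
    | ex j φ ih => exact .rule ih ih (.inr (.inr ⟨j, .inr ⟨rfl, rfl⟩⟩))

@[fun_prop] theorem SigmaFn.neg {f : α → PreFormula} (hf : SigmaFn f) :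
    SigmaFn fun a => PreFormula.neg (f a) := SigmaFn.neg'.comp hf

theorem PreTerm.le_code_of_mem_FV {t : PreTerm} {j : ℕ} (h : j ∈ t.FV) : j ≤ code t := by
  change j ≤ t.godelNum
  induction t with
  | var i =>
    obtain rfl : j = i := by simpa [PreTerm.FV] using h
    exact (le_cantorPair_right _ _).trans (Nat.le_succ _)
  | zero => simp [PreTerm.FV] at h
  | succ t ih => exact (ih h).trans ((le_cantorPair_right _ _).trans (Nat.le_succ _))
  | add s t h1 h2 | mul s t h1 h2 =>
    rcases Finset.mem_union.1 h with h | h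
    · exact (h1 h).trans ((le_cantorPair_right _ _).trans ((Nat.le_succ _).trans
        ((le_cantorPair_left _ _).trans (Nat.le_succ _))))
    · exact (h2 h).trans ((le_cantorPair_right _ _).trans (Nat.le_succ _))

theorem PreFormula.le_code_of_mem_FV {φ : PreFormula} {j : ℕ} (h : j ∈ φ.FV) : j ≤ code φ := by
  change j ≤ φ.godelNum
  induction φ with
  | eq s t | ne s t | le s t | nle s t =>
    rcases Finset.mem_union.1 h with h | h
    · exact (PreTerm.le_code_of_mem_FV h).trans ((le_cantorPair_right _ _).trans
        ((Nat.le_succ _).trans ((le_cantorPair_left _ _).trans (Nat.le_succ _))))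
    · exact (PreTerm.le_code_of_mem_FV h).trans ((le_cantorPair_right _ _).trans (Nat.le_succ _))
  | and s t h1 h2 | or s t h1 h2 =>
    rcases Finset.mem_union.1 h with h | h
    · exact (h1 h).trans ((le_cantorPair_right _ _).trans ((Nat.le_succ _).trans
        ((le_cantorPair_left _ _).trans (Nat.le_succ _))))
    · exact (h2 h).trans ((le_cantorPair_right _ _).trans (Nat.le_succ _))
  | all i φ ih | ex i φ ih =>
    exact (ih (Finset.mem_of_mem_erase h)).trans ((le_cantorPair_right _ _).trans (Nat.le_succ _))

/-- As the free variables are bounded by the code, being a term is expressed by a bounded quantifier. -/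
@[fun_prop] theorem SigmaPred.isTerm {f : α → PreTerm} (hf : SigmaFn f) :
    SigmaPred fun a => (f a).IsTerm := by
  have : SigmaPred fun a => ∀ i < code (f a) + 1, 2 * i ∉ (f a).FV := by fun_prop
  refine this.congr fun a => ⟨fun h i _ => h.not_even_mem i, fun h j hj => ?_⟩
  by_contra ho
  obtain ⟨i, rfl⟩ := even_iff_two_dvd.1 (Nat.not_odd_iff_even.1 ho)
  have := PreTerm.le_code_of_mem_FV hj
  exact h i (by omega) hj

@[fun_prop] theorem SigmaPred.isFormula {f : α → PreFormula} (hf : SigmaFn f) :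
    SigmaPred fun a => (f a).IsFormula := by
  have : SigmaPred fun a => ∀ i < code (f a) + 1, 2 * i ∉ (f a).FV := by fun_prop
  refine this.congr fun a => ⟨fun h i _ hi => ?_, fun h j hj => ?_⟩
  · exact Nat.not_odd_iff_even.2 (even_two_mul i) (h _ hi)
  · by_contra ho
    obtain ⟨i, rfl⟩ := even_iff_two_dvd.1 (Nat.not_odd_iff_even.1 ho)
    have := PreFormula.le_code_of_mem_FV hj
    exact h i (by omega) hj

@[fun_prop] theorem SigmaPred.isLiteral {f : α → PreFormula} (hf : SigmaFn f) :
    SigmaPred fun a => (f a).IsLiteral := by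
  have : SigmaPred fun a => ∃ s t, f a = .eq s t ∨ f a = .ne s t ∨ f a = .le s t ∨
      f a = .nle s t := by fun_prop
  refine this.congr fun a => ?_
  cases f a <;> simp [IsLiteral]

/-! ### Lists -/

/-- The code of a list, by iterated pairing. -/
def listCode : List α → ℕ
  | [] => 0
  | a :: l => cantorPair (code a) (listCode l) + 1

instance : SigmaType (List α) where
  code := listCode
  code_injective := by
    intro l
    induction l with
    | nil => rintro (_ | ⟨b, l'⟩) h <;> simp_all [listCode]
    | cons a l ih =>
      rintro (_ | ⟨b, l'⟩) h
      · simp [listCode] at h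
      · obtain ⟨h1, h2⟩ := cantorPair_inj.1 (Nat.succ_injective h)
        rw [code_injective h1, ih h2]
  sigmaSet_range := by
    refine (SigmaPred.of_gen (Ax := fun n => n = 0)
      (R := fun n m _ => ∃ a : α, n = cantorPair (code a) m + 1) ?_ ?_ ?_ ?_ ?_).sigmaSet
    · fun_prop
    · fun_prop
    · rintro _ rfl
      exact ⟨[], rfl⟩
    · rintro _ _ _ ⟨a, rfl⟩ ⟨l, rfl⟩ -
      exact ⟨a :: l, rfl⟩
    · rintro _ ⟨l, rfl⟩
      induction l with
      | nil => exact .ax rfl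
      | cons a l ih => exact .rule ih ih ⟨a, rfl⟩

@[fun_prop] theorem SigmaFn.cons {f : α → β} {g : α → List β} (hf : SigmaFn f) (hg : SigmaFn g) :
    SigmaFn fun a => f a :: g a := by
  refine .of_code (show SigmaFn fun a => FOArith.cantorPair (code (f a)) (code (g a)) + 1 from ?_)
  fun_prop

@[fun_prop] theorem SigmaPred.forall_mem {f : α → List β} {P : α → β → Prop} (hf : SigmaFn f)
    (hP : SigmaPred fun p : α × β => P p.1 p.2) : SigmaPred fun a => ∀ b ∈ f a, P a b := by
  have h : SigmaPred fun p : α × List β => ∀ b ∈ p.2, P p.1 b := by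
    refine SigmaPred.of_gen (Ax := fun p => p.2 = [])
      (R := fun p q _ => q.1 = p.1 ∧ ∃ b, P p.1 b ∧ p.2 = b :: q.2) ?_ ?_ ?_ ?_ ?_
    · fun_prop
    · refine .and (by fun_prop) (.ex (.and ?_ (by fun_prop)))
      exact hP.comp (f := fun p : ((α × List β) × (α × List β) × (α × List β)) × β =>
        (p.1.1.1, p.2)) (by fun_prop)
    · rintro ⟨a, _⟩ rfl
      simp
    · rintro ⟨a, _⟩ ⟨_, l⟩ _ ⟨rfl, b, hb, rfl⟩ hl -
      simpa [hb] using hl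
    · rintro ⟨a, l⟩ hl
      induction l with
      | nil => exact .ax rfl
      | cons b l ih =>
        have h' := ih fun c hc => hl c (List.mem_cons_of_mem _ hc)
        exact .rule h' h' ⟨rfl, b, hl b List.mem_cons_self, rfl⟩
  exact h.comp (f := fun a => (a, f a)) (by fun_prop)

theorem SigmaPred.list_mem : SigmaPred fun p : α × List α => p.1 ∈ p.2 := by
  refine SigmaPred.of_gen (Ax := fun p : α × List α => ∃ l, p.2 = p.1 :: l)
    (R := fun p q _ => q.1 = p.1 ∧ ∃ b, p.2 = b :: q.2) ?_ ?_ ?_ ?_ ?_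
  · fun_prop
  · fun_prop
  · rintro ⟨a, l⟩ ⟨l', h⟩
    obtain rfl : l = a :: l' := h
    exact List.mem_cons_self
  · rintro ⟨a, _⟩ ⟨_, l⟩ _ ⟨rfl, b, rfl⟩ h -
    exact List.mem_cons_of_mem _ h
  · rintro ⟨a, l⟩ h
    induction l with
    | nil => simp at h
    | cons b l ih =>
      by_cases hab : a = b
      · exact .ax ⟨l, by rw [hab]⟩
      · have h' := ih (by simpa [hab] using h)
        exact .rule h' h' ⟨rfl, b, rfl⟩

@[fun_prop] theorem SigmaPred.mem {f : α → β} {g : α → List β} (hf : SigmaFn f)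
    (hg : SigmaFn g) : SigmaPred fun a => f a ∈ g a :=
  SigmaPred.list_mem.comp (f := fun a => (f a, g a)) (by fun_prop)

variable {α β γ : Type} [SigmaType α] [SigmaType β] [SigmaType γ]

/-! ### Provability is `Σ` -/

/-- Axioms of the sequent calculus, for sequents given as lists. -/
def ListAx (l : List PreFormula) : Prop :=
  (∀ φ ∈ l, φ.IsFormula) ∧ ∃ φ, φ.IsLiteral ∧ φ ∈ l ∧ neg φ ∈ l

/-- The rules of the sequent calculus, for sequents given as lists, with conclusion `l` and premises
`l₁` and `l₂`. The principal formula is always kept in the premises, and weakening is a rule. -/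
def ListRule (l l₁ l₂ : List PreFormula) : Prop :=
  (∀ φ ∈ l, φ.IsFormula) ∧
  ((∃ φ ψ, PreFormula.and φ ψ ∈ l ∧ l₁ = φ :: l ∧ l₂ = ψ :: l) ∨
  (∃ φ ψ, PreFormula.or φ ψ ∈ l ∧ (l₁ = φ :: l ∨ l₁ = ψ :: l)) ∨
  (∃ i φ k, all i φ ∈ l ∧ (∀ θ ∈ l, 2 * k + 1 ∉ θ.FV) ∧
    l₁ = φ.subst (2 * i) (.var (2 * k + 1)) :: l) ∨
  (∃ i φ t, ex i φ ∈ l ∧ t.IsTerm ∧ l₁ = φ.subst (2 * i) t :: l) ∨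
  (∃ φ, φ.IsFormula ∧ l₁ = φ :: l ∧ l₂ = neg φ :: l) ∨
  ∀ φ ∈ l₁, φ ∈ l)

/-- The calculus of lists is sound for the sequent calculus. -/
theorem Gen.derivable {l : List PreFormula} (h : Gen ListAx ListRule l) :
    Derivable l.toFinset := by
  have hs : ∀ {l : List PreFormula}, (∀ φ ∈ l, φ.IsFormula) → IsSequent l.toFinset :=
    fun h φ hφ => h φ (by simpa using hφ)
  induction h with
  | ax h =>
    obtain ⟨hf, φ, hlit, h1, h2⟩ := h
    exact .ax (hs hf) φ hlit (by simpa using h1) (by simpa using h2)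
  | @rule l l₁ l₂ _ _ h h1 h2 =>
    obtain ⟨hf, h⟩ := h
    have hΓ := hs hf
    -- A formula of `l` may be contracted with the principal formula of an inference.
    have hins : ∀ {φ}, φ ∈ l → insert φ l.toFinset = l.toFinset := fun h =>
      Finset.insert_eq_of_mem (by simpa using h)
    rcases h with ⟨φ, ψ, hmem, rfl, rfl⟩ | ⟨φ, ψ, hmem, rfl | rfl⟩ | ⟨i, φ, k, hmem, hk, rfl⟩ |
      ⟨i, φ, t, hmem, ht, rfl⟩ | ⟨φ, hφ, rfl, rfl⟩ | hsub
    · rw [← hins hmem] at hΓ ⊢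
      exact .and hΓ (by simpa using h1) (by simpa using h2)
    · rw [← hins hmem] at hΓ ⊢
      exact .or_left hΓ (by simpa using h1)
    · rw [← hins hmem] at hΓ ⊢
      exact .or_right hΓ (by simpa using h1)
    · have := Derivable.all (Γ' := l.toFinset) ((hins hmem).symm ▸ hΓ) subset_rfl _
        (odd_two_mul_add_one k) (by rw [hins hmem]; simpa using hk) (by simpa using h1)
      rwa [hins hmem] at this
    · rw [← hins hmem] at hΓ ⊢
      exact .ex hΓ t ht (by simpa using h1)
    · exact .cut hΓ φ hφ (by simpa using h1) (by simpa using h2)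
    · exact h1.weaken (fun φ hφ => by simpa using hsub φ (by simpa using hφ)) hΓ

/-- The calculus of lists is complete for the sequent calculus. -/
theorem Derivable.gen {Γ : Finset PreFormula} (h : Derivable Γ) {l : List PreFormula}
    (hl : ∀ φ ∈ l, φ.IsFormula) (hΓ : ∀ φ ∈ Γ, φ ∈ l) : Gen ListAx ListRule l := by
  -- The premises of an inference, read as lists.
  have hcons : ∀ {Γ : Finset PreFormula} {φ : PreFormula} {l : List PreFormula},
      Derivable (insert φ Γ) → (∀ φ ∈ l, φ.IsFormula) → (∀ ψ ∈ Γ, ψ ∈ l) →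
      (∀ ψ ∈ φ :: l, ψ.IsFormula) ∧ ∀ ψ ∈ insert φ Γ, ψ ∈ φ :: l := by
    intro Γ φ l hd hl hΓ
    refine ⟨fun ψ hψ => ?_, fun ψ hψ => ?_⟩
    · rcases List.mem_cons.1 hψ with rfl | hψ
      exacts [hd.isSequent _ (Finset.mem_insert_self _ _), hl ψ hψ]
    · rcases Finset.mem_insert.1 hψ with rfl | hψ
      exacts [List.mem_cons_self, List.mem_cons_of_mem _ (hΓ ψ hψ)]
  induction h generalizing l with
  | ax _ φ hlit h₁ h₂ => exact .ax ⟨hl, φ, hlit, hΓ _ h₁, hΓ _ h₂⟩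
  | @and Γ φ ψ _ h₁ h₂ ih₁ ih₂ =>
    obtain ⟨hm, hΓ⟩ := Finset.forall_mem_insert _ _ _ |>.1 hΓ
    obtain ⟨h1, h2⟩ := hcons h₁ hl hΓ
    obtain ⟨h3, h4⟩ := hcons h₂ hl hΓ
    exact .rule (ih₁ h1 h2) (ih₂ h3 h4) ⟨hl, .inl ⟨φ, ψ, hm, rfl, rfl⟩⟩
  | @or_left Γ φ ψ _ h ih =>
    obtain ⟨hm, hΓ⟩ := Finset.forall_mem_insert _ _ _ |>.1 hΓ
    obtain ⟨h1, h2⟩ := hcons h hl hΓ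
    exact .rule (ih h1 h2) (ih h1 h2) ⟨hl, .inr (.inl ⟨φ, ψ, hm, .inl rfl⟩)⟩
  | @or_right Γ φ ψ _ h ih =>
    obtain ⟨hm, hΓ⟩ := Finset.forall_mem_insert _ _ _ |>.1 hΓ
    obtain ⟨h1, h2⟩ := hcons h hl hΓ
    exact .rule (ih h1 h2) (ih h1 h2) ⟨hl, .inr (.inl ⟨φ, ψ, hm, .inr rfl⟩)⟩
  | @all Γ Γ' i φ hseq hsub y hy hfresh h ih =>
    -- The variable `y` need not be fresh for `l`, but it is for a list of the elements of
    -- `Γ', ∀ x φ`, from which `l` follows by weakening.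
    have hl' : ∀ θ ∈ (insert (PreFormula.all i φ) Γ').toList, θ ∈ l := by
      intro θ hθ
      rcases Finset.mem_insert.1 (Finset.mem_toList.1 hθ) with rfl | hθ
      exacts [hΓ _ (Finset.mem_insert_self _ _), hΓ _ (Finset.mem_insert_of_mem (hsub hθ))]
    have hf' := fun θ hθ => hl θ (hl' θ hθ)
    obtain ⟨h1, h2⟩ := hcons h hf' fun ψ hψ =>
      Finset.mem_toList.2 (Finset.mem_insert_of_mem hψ)
    obtain ⟨k, rfl⟩ := hy
    have hall : Gen ListAx ListRule (insert (PreFormula.all i φ) Γ').toList :=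
      .rule (ih h1 h2) (ih h1 h2) ⟨hf', .inr (.inr (.inl ⟨i, φ, k,
        Finset.mem_toList.2 (Finset.mem_insert_self _ _),
        fun θ hθ => hfresh θ (Finset.mem_toList.1 hθ), rfl⟩))⟩
    exact .rule hall hall ⟨hl, .inr (.inr (.inr (.inr (.inr hl'))))⟩
  | @ex Γ i φ _ t ht h ih =>
    obtain ⟨hm, hΓ⟩ := Finset.forall_mem_insert _ _ _ |>.1 hΓ
    obtain ⟨h1, h2⟩ := hcons h hl hΓ
    exact .rule (ih h1 h2) (ih h1 h2) ⟨hl, .inr (.inr (.inr (.inl ⟨i, φ, t, hm, ht, rfl⟩)))⟩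
  | @cut Γ _ φ hφ h₁ h₂ ih₁ ih₂ =>
    obtain ⟨h1, h2⟩ := hcons h₁ hl hΓ
    obtain ⟨h3, h4⟩ := hcons h₂ hl hΓ
    exact .rule (ih₁ h1 h2) (ih₂ h3 h4)
      ⟨hl, .inr (.inr (.inr (.inr (.inl ⟨φ, hφ, rfl, rfl⟩))))⟩

theorem SigmaPred.gen_list : SigmaPred (Gen ListAx ListRule) := by
  refine .gen ?_ ?_
  · unfold ListAx
    fun_prop
  · unfold ListRule
    fun_prop

theorem provable_iff {T : Set PreFormula} {φ : PreFormula} :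
    Provable T φ ↔ ∃ l : List PreFormula, (∀ χ ∈ l, ∃ θ ∈ T, χ = neg θ) ∧
      Gen ListAx ListRule (φ :: l) := by
  constructor
  · rintro ⟨s, hs, hd⟩
    refine ⟨(s.image neg).toList, fun χ hχ => ?_, hd.gen (fun ψ hψ => hd.isSequent ψ ?_) ?_⟩
    · obtain ⟨θ, hθ, rfl⟩ := Finset.mem_image.1 (Finset.mem_toList.1 hχ)
      exact ⟨θ, hs hθ, rfl⟩
    · simpa using hψ
    · simp
  · rintro ⟨l, hl, hd⟩
    choose! f hf using hl
    refine ⟨(l.map f).toFinset, fun θ hθ => ?_, ?_⟩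
    · obtain ⟨χ, hχ, rfl⟩ : ∃ χ ∈ l, f χ = θ := by simpa using hθ
      exact (hf χ hχ).1
    · have : (l.map f).toFinset.image neg = l.toFinset := by
        ext χ
        simp only [Finset.mem_image, List.mem_toFinset, List.mem_map]
        constructor
        · rintro ⟨_, ⟨χ', h, rfl⟩, rfl⟩
          rwa [← (hf χ' h).2]
        · exact fun h => ⟨f χ, ⟨χ, h, rfl⟩, (hf χ h).2.symm⟩
      rw [this]
      simpa using hd.derivable

theorem SigmaPred.provable {T : Set PreFormula} (hT : SigmaDefinable (PreFormula.godelNum '' T)) :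
    SigmaPred fun φ => Provable T φ := by
  have hmem : SigmaPred fun θ => θ ∈ T :=
    SigmaEnv.sigmaSet (SigmaEnv.mem hT.sigmaSet 0) fun η => by
      simp only [Codes, Set.mem_image, mul_zero]
      exact exists_congr fun θ => and_comm
  have hneg : SigmaPred fun χ => ∃ θ ∈ T, χ = neg θ :=
    .ex (.and (hmem.comp (f := fun p : PreFormula × PreFormula => p.2) (by fun_prop))
      (by fun_prop))
  refine SigmaPred.congr (.ex (.and (.forall_mem (by fun_prop) ?_) ?_)) fun φ => provable_iff
  · exact hneg.comp (f := fun p : (PreFormula × List PreFormula) × PreFormula => p.2)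
      (by fun_prop)
  · exact SigmaPred.gen_list.comp (f := fun p : PreFormula × List PreFormula => p.1 :: p.2)
      (by fun_prop)

/-! ### The incompleteness theorem -/

/-- A consistent theory does not prove a formula and its negation, by the cut rule. -/
theorem Consistent.not_provable_neg {T : Set PreFormula} (hT : IsTheory T) (h : Consistent T)
    {φ : PreFormula} (hφ : φ.IsFormula) (h₁ : Provable T φ) : ¬ Provable T φ.neg := by
  rintro ⟨s', hs', hd'⟩
  obtain ⟨s, hs, hd⟩ := h₁
  apply h
  have hseq : IsSequent (insert falsum ((s ∪ s').image neg)) := by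
    intro θ hθ
    rcases Finset.mem_insert.1 hθ with rfl | hθ
    · simp [IsFormula, falsum, PreFormula.FV, PreTerm.FV]
    · obtain ⟨θ, hmem, rfl⟩ := Finset.mem_image.1 hθ
      refine (hT θ ?_).isFormula.neg
      exact (Finset.mem_union.1 hmem).elim (fun h => hs h) (fun h => hs' h)
  have hins : ∀ χ : PreFormula, χ.IsFormula →
      IsSequent (insert χ (insert falsum ((s ∪ s').image neg))) := by
    intro χ hχ θ hθ
    rcases Finset.mem_insert.1 hθ with rfl | hθ
    exacts [hχ, hseq θ hθ]
  refine ⟨s ∪ s', by simp [hs, hs'], .cut hseq φ hφ (hd.weaken ?_ (hins _ hφ))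
    (hd'.weaken ?_ (hins _ hφ.neg))⟩
  · exact Finset.insert_subset_insert _ ((Finset.image_subset_image Finset.subset_union_left).trans
      (Finset.subset_insert _ _))
  · exact Finset.insert_subset_insert _ ((Finset.image_subset_image Finset.subset_union_right).trans
      (Finset.subset_insert _ _))

end FOArith

open FOArith PreFormula SigmaType in
theorem mainTheorem2 (T : Set FOArith.PreFormula) (hT : FOArith.IsTheory T)
    (hQ : FOArith.robinsonQ ⊆ T)
    (hdef : FOArith.SigmaDefinable (FOArith.PreFormula.godelNum '' T))
    (hcon : FOArith.Consistent T) :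
    ∃ ψ : FOArith.PreFormula, ψ.IsSentence ∧ ψ.IsPi ∧
      ¬ FOArith.Provable T ψ ∧ ¬ FOArith.Provable T ψ.neg := by
  have hprov := SigmaPred.provable hdef
  -- The formulas `φ(x)` for which `φ(n)` is provable, where `n` is the Gödel number of `φ(x)`.
  have hA : SigmaSet fun n => ∃ φ : PreFormula, code φ = n ∧
      Provable T (φ.subst 0 (numeral n)) := by
    refine SigmaPred.sigmaSet (.ex (.and (by fun_prop) ?_))
    exact hprov.comp (f := fun p : ℕ × PreFormula => p.2.subst 0 (numeral p.1)) (by fun_prop)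
  -- The formulas `φ(x)` for which `¬ φ(n)` is provable, where `n` is the Gödel number of `φ(x)`.
  have hB : SigmaSet fun n => ∃ φ : PreFormula, code φ = n ∧
      Provable T (φ.subst 0 (numeral n)).neg := by
    refine SigmaPred.sigmaSet (.ex (.and (by fun_prop) ?_))
    exact hprov.comp (f := fun p : ℕ × PreFormula => (p.2.subst 0 (numeral p.1)).neg)
      (by fun_prop)
  obtain ⟨σ, hσ, hFV, hsep⟩ := exists_separating_formula_FV hA hB <| by
    rintro n ⟨φ, rfl, h₁⟩ ⟨φ', h, h₂⟩
    obtain rfl := code_injective h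
    have ⟨s, _, hd⟩ := h₁
    exact hcon.not_provable_neg hT (hd.isSequent _ (Finset.mem_insert_self _ _)) h₁ h₂
  -- The formula `σ(x)` at its own Gödel number.
  obtain ⟨χ, hχ⟩ : ∃ χ, χ = σ.subst 0 (numeral (code σ)) := ⟨_, rfl⟩
  have hsent : χ.IsSentence := by
    have := FV_subst_subset σ 0 (numeral (code σ))
    rw [← hχ, FV_numeral, Finset.union_empty] at this
    refine Finset.subset_empty.1 fun i hi => ?_
    obtain ⟨h0, hi⟩ := Finset.mem_erase.1 (this hi)
    exact absurd (Finset.mem_singleton.1 (hFV hi)) h0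
  have hsat : ∀ (M : Type) (S : ArithStr M) (η : ℕ → M),
      S.Sat η χ ↔ S.Sat (S.num ∘ fun _ => code σ) σ := by
    intro M S η
    rw [hχ, ArithStr.sat_subst _ _ _ _ _ (by simp), val_numeral]
    refine S.sat_congr σ fun i hi => ?_
    obtain rfl := Finset.mem_singleton.1 (hFV hi)
    simp
  have hnot : ¬ Provable T χ := fun h => by
    refine hcon.not_provable_neg hT hsent.isFormula h (provable_of_models hT hQ ?_ ?_)
    · rwa [IsSentence, FV_neg]
    · intro M S hS η
      rw [ArithStr.sat_neg, hsat]
      exact (hsep M S hS fun _ => code σ).2 ⟨σ, rfl, hχ ▸ h⟩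
  have hnot' : ¬ Provable T χ.neg := fun h => by
    refine hcon.not_provable_neg hT hsent.isFormula (provable_of_models hT hQ hsent ?_) h
    intro M S hS η
    rw [hsat]
    exact (hsep M S hS fun _ => code σ).1 ⟨σ, rfl, hχ ▸ h⟩
  refine ⟨χ.neg, by rwa [IsSentence, FV_neg], ?_, hnot', by rwa [neg_neg]⟩
  rw [IsPi, neg_neg, hχ]
  exact hσ.subst 0 _ (by simp)
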